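/- Let $p$ be a prime and let $k$ be an algebraically closed field of characteristic $p$ with Frobenius $\sigma$. A ${\rm DM}_1$ over $k$ of height $h$ is an $h$-dimensional $k$-vector space $N$ with a $\sigma$-linear map $F:N\to N$ and a $\sigma^{-1}$-linear map $V:N\to N$ such that $\ker F=\operatorname{im}V$ and $\ker V=\operatorname{im}F$. To $A=\delta_1\cdots\delta_h\in\{0,1\}^h$, with exactly $v$ zeros and with ones at the positions $i_1<\dots<i_u$, one associates the ${\rm DM}_1$ $N_A=\bigoplus_{i=1}^h ke_i$ given by $$Fe_i=\begin{cases}e_j,\ j=\#\{t\le i:\delta_t=0\}&\text{if }\delta_i=0,\\0&\text{if }\delta_i=1,\end{cases}\qquad Ve_j=\begin{cases}e_{i_{j-v}}&\text{if }j>v,\\0&\text{if }j\le v.\end{cases}$$ This gives a bijection between $\{0,1\}^h$ and the isomorphism classes of ${\rm DM}_1$'s over $k$ of height $h$; we say that $A$ corresponds to $N$ if $N\cong N_A$, and $A\oplus B$ denotes the sequence corresponding to $N_A\oplus N_B$. For $A,B\in\{0,1\}^h$, call $(B,A)$ an elementary step if one can write $A=P\oplus Q$ and $B=P\oplus Q'$,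 where $P$ is a possibly empty sequence and $Q'$ is constructed from $Q$ by exchanging one adjacent subsequence "$0\,1$" for "$1\,0$". Write $B<A$ if there is a finite chain of one or more elementary steps from $B$ to $A$. A Newton polygon $\xi=\sum_{i=1}^t(m_i,n_i)$ is a finite multiset of pairs of coprime non-negative integers, arranged so that the slopes $\lambda_i=n_i/(m_i+n_i)$ satisfy $\lambda_1\ge\dots\ge\lambda_t$. Its height is $h=\sum_i(m_i+n_i)$. It is regarded as the downward-convex line graph over $[0,h]$ from $(0,0)$ to $(h,\sum_i n_i)$ with breaking points $\sum_{i>j}(m_i+n_i,n_i)$, $0\le j\le t$, and $\xi(x)$ denotes its value at $x$. Write $\zeta\prec\xi$ if $\zeta$ and $\xi$ have the same ending point and every point of $\zeta$ is above or on $\xi$; for such $\zeta,\xi$ of height $h$ put $$c(\zeta,\xi)=2\sum_{i=1}^h(\zeta(i)-\xi(i)),$$ which is twice the area between the two graphs. The minimal ${\rm DM}_1$ of $\xi$ is $N_\xi=\bigoplus_i N_{m_i,n_i}$, where $N_{m,n}$ is the ${\rm DM}_1$ of the sequence $1\cdots1\,0\cdots0$ with $m$ ones followed by $n$ zeros. **Theorem.**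 Let $\zeta\prec\xi$ be Newton polygons of height $h$. Then $c=c(\zeta,\xi)$ is a non-negative integer, and there are ${\rm DM}_1$'s $M_0,M_1,\dots,M_c$ over $k$ with $M_0=N_\zeta$ and $M_c=N_\xi$, with corresponding sequences $A^{(0)},\dots,A^{(c)}\in\{0,1\}^h$, such that $$A^{(0)}<A^{(1)}<\cdots<A^{(c)},$$ where each pair $(A^{(i-1)},A^{(i)})$, $1\le i\le c$, is a single elementary step. -/

import Mathlib

universe u

/-! ### Truncated Dieudonne modules of level one -/

/-- A truncated Dieudonne module of level one (`DM₁`) over a perfect field `k` of characteristic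
`p`: a finite-dimensional `k`-vector space with a `σ`-linear map `F` and a `σ⁻¹`-linear map `V`
(`σ` the Frobenius of `k`) such that `Ker F = Im V` and `Ker V = Im F`. -/
structure DMOne (p : ℕ) [Fact p.Prime] (k : Type u) [Field k] [CharP k p] [PerfectRing k p] where
  /-- the underlying vector space -/
  carrier : Type u
  [addCommGroup : AddCommGroup carrier]
  [module : Module k carrier]
  [finite : Module.Finite k carrier]
  /-- the `σ`-linear operator -/
  F : carrier →ₛₗ[(frobeniusEquiv k p : k →+* k)] carrier
  /-- the `σ⁻¹`-linear operator -/
  V : carrier →ₛₗ[((frobeniusEquiv k p).symm : k →+* k)] carrier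
  /-- `Ker F = Im V` -/
  ker_F : ∀ x, F x = 0 ↔ ∃ y, V y = x
  /-- `Ker V = Im F` -/
  ker_V : ∀ x, V x = 0 ↔ ∃ y, F y = x

attribute [instance] DMOne.addCommGroup DMOne.module DMOne.finite

namespace DMOne

variable {p : ℕ} [Fact p.Prime] {k : Type u} [Field k] [CharP k p] [PerfectRing k p]

/-- The height of a `DM₁` is its dimension. -/
noncomputable def height (M : DMOne p k) : ℕ := Module.finrank k M.carrier

/-- Isomorphism of `DM₁`'s: a `k`-linear isomorphism commuting with `F` and `V`. -/
def IsIso (M N : DMOne p k) : Prop :=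
  ∃ e : M.carrier ≃ₗ[k] N.carrier,
    (∀ x, e (M.F x) = N.F (e x)) ∧ (∀ x, e (M.V x) = N.V (e x))

/-- The direct sum `M ⊕ N` of two `DM₁`'s. -/
noncomputable def prod (M N : DMOne p k) : DMOne p k where
  carrier := M.carrier × N.carrier
  F :=
    { toFun := fun x => (M.F x.1, N.F x.2)
      map_add' := fun x y => by simp
      map_smul' := fun a x => by simp }
  V :=
    { toFun := fun x => (M.V x.1, N.V x.2)
      map_add' := fun x y => by simp
      map_smul' := fun a x => by simp }
  ker_F := fun x => by
    change (M.F x.1, N.F x.2) = 0 ↔ ∃ y : M.carrier × N.carrier, (M.V y.1, N.V y.2) = x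
    simp [Prod.ext_iff, M.ker_F, N.ker_F]
  ker_V := fun x => by
    change (M.V x.1, N.V x.2) = 0 ↔ ∃ y : M.carrier × N.carrier, (M.F y.1, N.F y.2) = x
    simp [Prod.ext_iff, M.ker_V, N.ker_V]

/-- The direct sum `⨁ i, M i` of a finite family of `DM₁`'s. -/
noncomputable def pi {ι : Type} [Fintype ι] (M : ι → DMOne p k) : DMOne p k where
  carrier := ∀ i, (M i).carrier
  F :=
    { toFun := fun x i => (M i).F (x i)
      map_add' := fun x y => by ext i; simp
      map_smul' := fun a x => by ext i; simp }
  V :=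
    { toFun := fun x i => (M i).V (x i)
      map_add' := fun x y => by ext i; simp
      map_smul' := fun a x => by ext i; simp }
  ker_F := fun x => by
    simp only [LinearMap.coe_mk, AddHom.coe_mk, funext_iff, Pi.zero_apply, (M _).ker_F]
    exact Classical.skolem
  ker_V := fun x => by
    simp only [LinearMap.coe_mk, AddHom.coe_mk, funext_iff, Pi.zero_apply, (M _).ker_V]
    exact Classical.skolem

end DMOne

/-! ### The `DM₁` of a sequence of zeros and ones

Positions are `0, …, h - 1`, so the basis vector `e_i` of the usual notation is the one with
index `i - 1` here. -/

/-- The set `{0,1}^h`. -/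
abbrev ZeroOneSeq (h : ℕ) : Type := Fin h → Fin 2

namespace ZeroOneSeq

/-- The number of positions `t < i` with `A t = x`. -/
def countBelow {h : ℕ} (A : ZeroOneSeq h) (x : Fin 2) (i : Fin h) : ℕ :=
  (Finset.univ.filter fun t : Fin h => t < i ∧ A t = x).card

/-- The number of positions `t` with `A t = x`. -/
def count {h : ℕ} (A : ZeroOneSeq h) (x : Fin 2) : ℕ :=
  (Finset.univ.filter fun t : Fin h => A t = x).card

theorem countBelow_lt_count {h : ℕ} (A : ZeroOneSeq h) (i : Fin h) :
    countBelow A (A i) i < count A (A i) := by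
  refine Finset.card_lt_card ⟨fun t ht => ?_, fun hsub => ?_⟩
  · simp only [Finset.mem_filter, Finset.mem_univ, true_and] at ht ⊢
    exact ht.2
  · have hi := hsub (Finset.mem_filter.2 ⟨Finset.mem_univ i, rfl⟩)
    simp at hi

theorem count_zero_add_count_one {h : ℕ} (A : ZeroOneSeq h) : count A 0 + count A 1 = h := by
  have hfilter : (Finset.univ.filter fun t : Fin h => A t = 1)
      = Finset.univ.filter fun t : Fin h => ¬ A t = 0 := by
    ext t
    simp only [Finset.mem_filter, Finset.mem_univ, true_and]
    omega
  unfold count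
  rw [hfilter, Finset.card_filter_add_card_filter_not]
  simp

theorem countBelow_lt_countBelow {h : ℕ} (A : ZeroOneSeq h) {i j : Fin h} (hij : i < j) :
    countBelow A (A i) i < countBelow A (A i) j := by
  refine Finset.card_lt_card ⟨fun t ht => ?_, fun hsub => ?_⟩
  · simp only [Finset.mem_filter, Finset.mem_univ, true_and] at ht ⊢
    exact ⟨ht.1.trans hij, ht.2⟩
  · have hi := hsub (Finset.mem_filter.2 ⟨Finset.mem_univ i, hij, rfl⟩)
    simp at hi

/-- The head of the arrow of the `(F, V⁻¹)`-diagram of `A` that starts at `i`: the arrow is an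
`F`-arrow if `A i = 0`, and a `V⁻¹`-arrow if `A i = 1`. -/
def arrow {h : ℕ} (A : ZeroOneSeq h) (i : Fin h) : Fin h :=
  ⟨if A i = 0 then countBelow A 0 i else count A 0 + countBelow A 1 i, by
    have hlt := countBelow_lt_count A i
    have hsum := count_zero_add_count_one A
    have hcases : A i = 0 ∨ A i = 1 := by omega
    rcases hcases with hi | hi <;> rw [hi] at hlt <;> simp [hi] <;> omega⟩

theorem arrow_injective {h : ℕ} (A : ZeroOneSeq h) : Function.Injective (arrow A) := by
  intro i j hij
  have hval := congrArg Fin.val hij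
  have hil := countBelow_lt_count A i
  have hjl := countBelow_lt_count A j
  have hmono := fun hlt : i < j => countBelow_lt_countBelow A hlt
  have hmono' := fun hlt : j < i => countBelow_lt_countBelow A hlt
  have hcasei : A i = 0 ∨ A i = 1 := by omega
  have hcasej : A j = 0 ∨ A j = 1 := by omega
  simp only [arrow] at hval
  rcases lt_trichotomy i j with hlt | heq | hlt
  · have := hmono hlt
    rcases hcasei with hi | hi <;> rcases hcasej with hj | hj <;> simp_all <;> omega
  · exact heq
  · have := hmono' hlt
    rcases hcasei with hi | hi <;> rcases hcasej with hj | hj <;> simp_all <;> omega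

/-- `arrow A` as a permutation of the positions. -/
noncomputable def arrowEquiv {h : ℕ} (A : ZeroOneSeq h) : Equiv.Perm (Fin h) :=
  Equiv.ofBijective (arrow A) (Finite.injective_iff_bijective.1 (arrow_injective A))

variable (p : ℕ) [Fact p.Prime] (k : Type u) [Field k] [CharP k p] [PerfectRing k p]

/-- The `DM₁` `N = k e_1 ⊕ ⋯ ⊕ k e_h` of a sequence `A`. Here `F e_i = e_{arrow i}` if `A i = 0`
and `F e_i = 0` if `A i = 1`, while `V e_{arrow i} = e_i` if `A i = 1` and `V e_{arrow i} = 0` if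
`A i = 0`. -/
noncomputable def toDMOne {h : ℕ} (A : ZeroOneSeq h) : DMOne p k where
  carrier := Fin h → k
  F :=
    { toFun := fun x j =>
        if A ((arrowEquiv A).symm j) = 0 then frobeniusEquiv k p (x ((arrowEquiv A).symm j)) else 0
      map_add' := fun x y => by
        ext j
        simp only [Pi.add_apply]
        split_ifs <;> simp
      map_smul' := fun a x => by
        ext j
        simp only [Pi.smul_apply, smul_eq_mul]
        split_ifs <;> simp }
  V :=
    { toFun := fun x i =>
        if A i = 1 then (frobeniusEquiv k p).symm (x (arrowEquiv A i)) else 0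
      map_add' := fun x y => by
        ext j
        simp only [Pi.add_apply]
        split_ifs <;> simp
      map_smul' := fun a x => by
        ext j
        simp only [Pi.smul_apply, smul_eq_mul]
        split_ifs <;> simp }
  ker_F := fun x => by
    simp only [LinearMap.coe_mk, AddHom.coe_mk, funext_iff, Pi.zero_apply]
    constructor
    · intro hx
      refine ⟨fun j => frobeniusEquiv k p (x ((arrowEquiv A).symm j)), fun i => ?_⟩
      have hi := hx (arrowEquiv A i)
      simp only [Equiv.symm_apply_apply] at hi ⊢
      have hcases : A i = 0 ∨ A i = 1 := by omega
      rcases hcases with h0 | h1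
      · simp only [h0, if_true, EmbeddingLike.map_eq_zero_iff] at hi
        simp [h0, hi]
      · simp [h1]
    · rintro ⟨y, hy⟩ j
      by_cases h0 : A ((arrowEquiv A).symm j) = 0
      · have := hy ((arrowEquiv A).symm j)
        simp [h0] at this
        simp [← this]
      · simp [h0]
  ker_V := fun x => by
    simp only [LinearMap.coe_mk, AddHom.coe_mk, funext_iff, Pi.zero_apply]
    constructor
    · intro hx
      refine ⟨fun i => (frobeniusEquiv k p).symm (x (arrowEquiv A i)), fun j => ?_⟩
      have hj := hx ((arrowEquiv A).symm j)
      simp only [Equiv.apply_symm_apply, RingEquiv.apply_symm_apply] at hj ⊢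
      have hcases : A ((arrowEquiv A).symm j) = 0 ∨ A ((arrowEquiv A).symm j) = 1 := by omega
      rcases hcases with h0 | h1
      · simp [h0]
      · simp only [h1, if_true, EmbeddingLike.map_eq_zero_iff] at hj
        simp [h1, hj]
    · rintro ⟨y, hy⟩ i
      by_cases h1 : A i = 1
      · have := hy (arrowEquiv A i)
        simp [h1] at this
        simp [← this]
      · simp [h1]

end ZeroOneSeq

section Sequences

variable {p : ℕ} [Fact p.Prime] {k : Type u} [Field k] [CharP k p] [PerfectRing k p]

/-- `A` is the sequence corresponding to the `DM₁` `M`, that is, `M` is isomorphic to the `DM₁`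
of `A`. Over an algebraically closed field this is the graph of the bijection between `{0,1}^h`
and the isomorphism classes of `DM₁`'s of height `h`. -/
def DMOne.Corresponds (M : DMOne p k) {h : ℕ} (A : ZeroOneSeq h) : Prop :=
  M.IsIso (A.toDMOne p k)

end Sequences

namespace ZeroOneSeq

variable (p : ℕ) [Fact p.Prime] (k : Type u) [Field k] [CharP k p] [PerfectRing k p]

/-- `C = A ⊕ B`: the sequence `C` corresponds to the direct sum of the `DM₁`'s of `A` and `B`. -/
def IsDirectSum {a b c : ℕ} (A : ZeroOneSeq a) (B : ZeroOneSeq b) (C : ZeroOneSeq c) : Prop :=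
  ((A.toDMOne p k).prod (B.toDMOne p k)).Corresponds C

/-- `Q'` is constructed from `Q` by exchanging one adjacent subsequence `0 1` for `1 0`. -/
def IsAdjacentExchange {b : ℕ} (Q' Q : ZeroOneSeq b) : Prop :=
  ∃ i j : Fin b, (j : ℕ) = i + 1 ∧ Q i = 0 ∧ Q j = 1 ∧ Q' = Q ∘ Equiv.swap i j

/-- One step `B = P ⊕ Q'`, `A = P ⊕ Q`, where `Q'` is constructed from `Q` by exchanging an
adjacent subsequence `0 1` for `1 0`. The summand `P` may be empty. -/
def IsElementaryStep {h : ℕ} (B A : ZeroOneSeq h) : Prop :=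
  ∃ (a b : ℕ) (P : ZeroOneSeq a) (Q' Q : ZeroOneSeq b),
    IsAdjacentExchange Q' Q ∧ IsDirectSum p k P Q' B ∧ IsDirectSum p k P Q A

/-- The relation `B < A`: there is a finite chain of at least one elementary step from `B`
to `A`. -/
def LT {h : ℕ} (B A : ZeroOneSeq h) : Prop :=
  Relation.TransGen (IsElementaryStep p k (h := h)) B A

end ZeroOneSeq

/-! ### Newton polygons -/

/-- The slope `n / (m + n)` of a pair `(m, n)`. -/
noncomputable def segmentSlope (s : ℕ × ℕ) : ℝ := (s.2 : ℝ) / ((s.1 : ℝ) + (s.2 : ℝ))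

/-- A Newton polygon: a finite multiset of pairs `(m_i, n_i)` of coprime non-negative integers,
given by its unique arrangement with non-increasing slopes `n_i / (m_i + n_i)` (coprime pairs
with equal slopes are equal). -/
structure NewtonPolygon where
  /-- the pairs `(m_1, n_1), …, (m_t, n_t)` -/
  segs : List (ℕ × ℕ)
  coprime : ∀ s ∈ segs, Nat.Coprime s.1 s.2
  sorted : segs.Pairwise fun s t => segmentSlope t ≤ segmentSlope s

namespace NewtonPolygon

/-- `∑ (m_i + n_i)` over a list of pairs. -/
def listHeight (l : List (ℕ × ℕ)) : ℕ := (l.map fun s => s.1 + s.2).sum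

/-- `∑ n_i` over a list of pairs. -/
def listDim (l : List (ℕ × ℕ)) : ℕ := (l.map fun s => s.2).sum

/-- The height `∑ (m_i + n_i)` of a Newton polygon. -/
def height (ξ : NewtonPolygon) : ℕ := listHeight ξ.segs

/-- The dimension `∑ n_i` of a Newton polygon. -/
def dim (ξ : NewtonPolygon) : ℕ := listDim ξ.segs

/-- The line graph that starts at `(0, 0)` and has the breaking points
`∑_{i > j} (m_i + n_i, n_i)`: the first pair of the list is the last segment of the graph. -/
noncomputable def listGraph : List (ℕ × ℕ) → ℝ → ℝ
  | [], _ => 0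
  | s :: l, x =>
    if x ≤ (listHeight l : ℝ) then listGraph l x
    else (listDim l : ℝ) + segmentSlope s * (x - (listHeight l : ℝ))

/-- The Newton polygon as a function on `[0, h]`. -/
noncomputable def graph (ξ : NewtonPolygon) (x : ℝ) : ℝ := listGraph ξ.segs x

/-- `ζ ≺ ξ`: the polygons have the same ending point, and each point of `ζ` is above or on `ξ`. -/
def Prec (ζ ξ : NewtonPolygon) : Prop :=
  ζ.height = ξ.height ∧ ζ.dim = ξ.dim ∧
    ∀ x ∈ Set.Icc (0 : ℝ) (ξ.height : ℝ), ξ.graph x ≤ ζ.graph x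

/-- `c(ζ, ξ) = 2 ∑_{i = 1}^h (ζ(i) - ξ(i))`, for polygons of height `h`. -/
noncomputable def c (ζ ξ : NewtonPolygon) : ℝ :=
  2 * ∑ i ∈ Finset.Icc 1 ξ.height, (ζ.graph (i : ℝ) - ξ.graph (i : ℝ))

end NewtonPolygon

/-- The sequence `A_{m,n} = 1 ⋯ 1 0 ⋯ 0` with `m` ones followed by `n` zeros. -/
def simpleSeq (m n : ℕ) : ZeroOneSeq (m + n) := fun i => if (i : ℕ) < m then 1 else 0

/-- The minimal `DM₁` `N_ξ = ⨁ N_{m_i, n_i}` of a Newton polygon `ξ = ∑ (m_i, n_i)`, where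
`N_{m,n}` is the `DM₁` of `A_{m,n}`. -/
noncomputable def minimalDMOne (p : ℕ) [Fact p.Prime] (k : Type u) [Field k] [CharP k p]
    [PerfectRing k p] (ξ : NewtonPolygon) : DMOne p k :=
  DMOne.pi fun i : Fin ξ.segs.length =>
    (simpleSeq (ξ.segs.get i).1 (ξ.segs.get i).2).toDMOne p k

/-! The `F`- and `V⁻¹`-arrows of `N_A` permute a basis whose elements carry labels 0 and 1. Direct
sums and elementary steps are therefore studied on labelled self-maps, and `Realizes` carries the
results back to modules. The arrow of a sequence is the stable sorting of its positions by label,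
and this monotonicity characterises it (`eq_arrow`).

Geometrically, the lower polygon `ξ` is raised towards `ζ` one corner at a time. At a corner off
`ζ`, the two segments `e₁, e₂` are replaced by the lower hull of the lattice points above them
without the corner (`IsHull`). Each hull segment has lattice distance one from the corner, so the
doubled area swept out is the number of hull segments (`IsHull.twiceSum`), and no vertex of `ζ` is
passed (`LiesAbove.raise`). It remains to join the hull to `N_{e₁} ⊕ N_{e₂}` by exactly that many
steps (`exists_isHull`); adding these numbers over all corners gives `c`.

For one corner, Euclid's algorithm reduces to slopes on different sides of 1/2: inserting a 1 after
every 0, or a 0 after every 1, carries steps to steps and acts on pairs by a shear. In the remaining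
case one exchange merges the two simple sequences, and each further exchange splits off one hull
segment. Splittings are found by two-colouring positions: if sorting by label preserves the colour
pattern, the sequence is the direct sum of its colour classes (`ofList_iso_sum_of_color`). The
colouring is a Sturmian word, invariant under the arrow of `1^m 0^n` up to one adjacent
transposition (`exists_coloring`), and this is the defect that an exchange of `0 1` repairs. -/

/-! ### Labelled self-maps -/

/-- A set with a self-map and a labelling by zeros and ones. -/
structure LabelledMap where
  /-- the underlying set -/
  carrier : Type
  /-- the self-map -/
  map : carrier → carrier
  /-- the labels -/
  label : carrier → Fin 2

namespace LabelledMap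

/-- Isomorphism of labelled self-maps. -/
def Iso (X Y : LabelledMap) : Prop :=
  ∃ e : X.carrier ≃ Y.carrier, (∀ x, Y.label (e x) = X.label x) ∧ ∀ x, e (X.map x) = Y.map (e x)

theorem Iso.refl (X : LabelledMap) : Iso X X := ⟨Equiv.refl _, fun _ => rfl, fun _ => rfl⟩

theorem Iso.symm {X Y : LabelledMap} : Iso X Y → Iso Y X := by
  rintro ⟨e, h1, h2⟩
  refine ⟨e.symm, fun y => ?_, fun y => ?_⟩
  · rw [← h1, e.apply_symm_apply]
  · rw [e.symm_apply_eq, h2, e.apply_symm_apply]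

theorem Iso.trans {X Y Z : LabelledMap} : Iso X Y → Iso Y Z → Iso X Z := by
  rintro ⟨e, h1, h2⟩ ⟨f, h3, h4⟩
  exact ⟨e.trans f, fun x => by simp [h1, h3], fun x => by simp [h2, h4]⟩

/-- Disjoint union of labelled self-maps. -/
def sum (X Y : LabelledMap) : LabelledMap where
  carrier := X.carrier ⊕ Y.carrier
  map := Sum.map X.map Y.map
  label := Sum.elim X.label Y.label

/-- The empty labelled self-map. -/
def empty : LabelledMap where
  carrier := Empty
  map := id
  label := Empty.elim

/-- The labelled self-map of a sequence. -/
def ofSeq {h : ℕ} (A : ZeroOneSeq h) : LabelledMap where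
  carrier := Fin h
  map := A.arrow
  label := A

/-- The labelled self-map of a list of zeros and ones. -/
def ofList (l : List (Fin 2)) : LabelledMap := ofSeq (h := l.length) l.get

theorem Iso.sum {X X' Y Y' : LabelledMap} : Iso X X' → Iso Y Y' → Iso (X.sum Y) (X'.sum Y') := by
  rintro ⟨e, h1, h2⟩ ⟨f, h3, h4⟩
  refine ⟨Equiv.sumCongr e f, ?_, ?_⟩ <;> rintro (x | x)
  · exact h1 x
  · exact h3 x
  · exact congrArg Sum.inl (h2 x)
  · exact congrArg Sum.inr (h4 x)

theorem sum_assoc (X Y Z : LabelledMap) : Iso ((X.sum Y).sum Z) (X.sum (Y.sum Z)) := by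
  refine ⟨Equiv.sumAssoc _ _ _, ?_, ?_⟩ <;> rintro ((x | x) | x) <;> rfl

theorem sum_comm (X Y : LabelledMap) : Iso (X.sum Y) (Y.sum X) := by
  refine ⟨Equiv.sumComm _ _, ?_, ?_⟩ <;> rintro (x | x) <;> rfl

theorem sum_empty (X : LabelledMap) : Iso (X.sum empty) X := by
  refine ⟨Equiv.sumEmpty _ Empty, ?_, ?_⟩ <;> rintro (x | ⟨⟨⟩⟩) <;> rfl

theorem empty_sum (X : LabelledMap) : Iso (empty.sum X) X :=
  (sum_comm _ _).trans (sum_empty X)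

theorem ofSeq_iso_ofList_ofFn {h : ℕ} (A : ZeroOneSeq h) : Iso (ofSeq A) (ofList (List.ofFn A)) := by
  have key : ∀ (n : ℕ) (hn : h = n) (B : ZeroOneSeq n), (∀ i, B (Fin.cast hn i) = A i) →
      Iso (ofSeq A) (ofSeq B) := by
    rintro n rfl B hB
    have : B = A := funext fun i => by simpa using hB i
    subst this
    exact Iso.refl _
  exact key _ (by simp) _ fun i => by simp

/-! ### Recognizing the map of a sequence -/

theorem arrow_lt_arrow {h : ℕ} (A : ZeroOneSeq h) {i j : Fin h}
    (hij : A i < A j ∨ (A i = A j ∧ i < j)) : A.arrow i < A.arrow j := by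
  have hi := A.countBelow_lt_count i
  rw [Fin.lt_def]
  rcases hij with hij | ⟨hij, hlt⟩
  · have h0 : A i = 0 := by omega
    have h1 : A j = 1 := by omega
    rw [h0] at hi
    simp [ZeroOneSeq.arrow, h0, h1]
    omega
  · have := A.countBelow_lt_countBelow hlt
    rcases (by omega : A i = 0 ∨ A i = 1) with h0 | h0 <;> rw [h0] at hij this <;>
      simp [ZeroOneSeq.arrow, h0, ← hij, this]

/-- A strictly increasing self-map of a finite chain is the identity. If `g` lists the positions by
label and then by place, `A.arrow ∘ g` is such a map. -/
theorem arrow_comp_eq {h n : ℕ} (A : ZeroOneSeq h) (hn : n = h) (g : Fin n → Fin h)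
    (hg : ∀ i j, i < j → A (g i) < A (g j) ∨ (A (g i) = A (g j) ∧ g i < g j)) (i : Fin n) :
    A.arrow (g i) = Fin.cast hn i := by
  subst hn
  have hmono : StrictMono fun i => A.arrow (g i) := fun i j hij => arrow_lt_arrow A (hg i j hij)
  have := (hmono.range_inj strictMono_id).1 (by
    rw [Set.range_id, Set.range_eq_univ]
    exact Finite.injective_iff_surjective.1 hmono.injective)
  exact congrFun this i

/-- Stable sorting has only one outcome. Restrictions, unions and substitutions are recognised as
sequences by this criterion. -/
theorem eq_arrow {h : ℕ} (A : ZeroOneSeq h) (f : Fin h → Fin h)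
    (hf : ∀ i j, A i < A j ∨ (A i = A j ∧ i < j) → f i < f j) : f = A.arrow := by
  have hinj : Function.Injective f := by
    intro i j hij
    by_contra hne
    have : (A i < A j ∨ (A i = A j ∧ i < j)) ∨ (A j < A i ∨ (A j = A i ∧ j < i)) := by omega
    rcases this with h1 | h1
    · exact (hf _ _ h1).ne hij
    · exact (hf _ _ h1).ne' hij
  let e := Equiv.ofBijective f (Finite.injective_iff_bijective.1 hinj)
  have key := arrow_comp_eq A rfl e.symm (by
    intro i j hij
    by_contra hcon
    have hne : e.symm i ≠ e.symm j := fun h => hij.ne (e.symm.injective h)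
    have := hf (e.symm j) (e.symm i) (by omega)
    have h1 : ∀ x, f (e.symm x) = x := fun x => e.apply_symm_apply x
    rw [h1, h1] at this
    exact absurd hij this.not_gt)
  funext i
  have := key (e i)
  rw [e.symm_apply_apply] at this
  rw [this]
  rfl

theorem iso_ofSeq {X : LabelledMap} {h : ℕ} (A : ZeroOneSeq h) (e : X.carrier ≃ Fin h)
    (hlabel : ∀ x, A (e x) = X.label x)
    (hmap : ∀ x y, X.label x < X.label y ∨ (X.label x = X.label y ∧ e x < e y) →
      e (X.map x) < e (X.map y)) : Iso X (ofSeq A) := by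
  refine ⟨e, hlabel, fun x => ?_⟩
  have := eq_arrow A (fun i => e (X.map (e.symm i))) (fun i j hij => hmap _ _ (by
    rw [← hlabel, ← hlabel]
    simpa using hij))
  have := congrFun this (e x)
  rw [e.symm_apply_apply] at this
  exact this

/-! ### Disjoint unions of sequences -/

/-- The labels met when going backwards from a position. -/
noncomputable def past {h : ℕ} (A : ZeroOneSeq h) (i : Fin h) (n : ℕ) : Fin 2 :=
  A (((A.arrowEquiv).symm^[n + 1]) i)

theorem past_arrow_zero {h : ℕ} (A : ZeroOneSeq h) (i : Fin h) : past A (A.arrow i) 0 = A i := by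
  have : A.arrowEquiv.symm (A.arrow i) = i := A.arrowEquiv.symm_apply_apply i
  simp [past, this]

theorem past_arrow_succ {h : ℕ} (A : ZeroOneSeq h) (i : Fin h) (n : ℕ) :
    past A (A.arrow i) (n + 1) = past A i n := by
  have : A.arrowEquiv.symm (A.arrow i) = i := A.arrowEquiv.symm_apply_apply i
  simp only [past]
  rw [Function.iterate_succ_apply, this]

/-- Following an arrow puts the present label in front of the past; this is the resulting comparison
of pasts. -/
theorem toLex_lt_toLex_of_shift {f g f' g' : ℕ → Fin 2} (hf : ∀ n, f' (n + 1) = f n)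
    (hg : ∀ n, g' (n + 1) = g n)
    (h : f' 0 < g' 0 ∨ (f' 0 = g' 0 ∧ toLex f < toLex g)) : toLex f' < toLex g' := by
  rcases h with h | ⟨h0, n, hn, hlt⟩
  · exact ⟨0, fun j hj => absurd hj (Nat.not_lt_zero _), h⟩
  · refine ⟨n + 1, fun j hj => ?_, ?_⟩
    · cases j with
      | zero => exact h0
      | succ j =>
        change f' (j + 1) = g' (j + 1)
        rw [hf, hg]
        exact hn j (by omega)
    · change f' (n + 1) < g' (n + 1)
      rw [hf, hg]
      exact hlt

theorem exists_iso_ofSeq {X : LabelledMap} {h : ℕ} (e : X.carrier ≃ Fin h) {κ : Type}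
    [LinearOrder κ] (key : X.carrier → κ) (hkey : Function.Injective key)
    (hmap : ∀ x y, X.label x < X.label y ∨ (X.label x = X.label y ∧ key x < key y) →
      key (X.map x) < key (X.map y)) : ∃ C : ZeroOneSeq h, Iso X (ofSeq C) := by
  let : LinearOrder X.carrier := LinearOrder.lift' key hkey
  let : Fintype X.carrier := Fintype.ofEquiv _ e.symm
  let o := (Fintype.orderIsoFinOfCardEq X.carrier
    ((Fintype.card_congr e).trans (Fintype.card_fin h))).symm
  refine ⟨fun i => X.label (o.symm i), iso_ofSeq _ o.toEquiv (fun x => ?_) fun x y hxy => ?_⟩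
  · exact congrArg X.label (o.symm_apply_apply x)
  · refine o.lt_iff_lt.2 (hmap x y ?_)
    rcases hxy with h | ⟨h, h'⟩
    · exact Or.inl h
    · exact Or.inr ⟨h, o.lt_iff_lt.1 h'⟩

/-- The points of the union are ordered lexicographically by their past labels, the most recent
first. Arrows respect this order among equal labels. Points with identical pasts are separated by
summand and position, which arrows respect as well. -/
theorem exists_sum_iso_ofSeq {a b : ℕ} (A : ZeroOneSeq a) (B : ZeroOneSeq b) :
    ∃ C : ZeroOneSeq (a + b), Iso ((ofSeq A).sum (ofSeq B)) (ofSeq C) := by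
  let key : Fin a ⊕ Fin b → Lex (Lex (ℕ → Fin 2) × Lex (Fin a ⊕ Fin b)) := fun x =>
    toLex (toLex (Sum.elim (past A) (past B) x), toLex x)
  have hkey : Function.Injective key := fun x y hxy => by
    have := congrArg (fun z => (ofLex z).2) hxy
    simpa [key] using this
  have h0 : ∀ z : Fin a ⊕ Fin b, Sum.elim (past A) (past B) (Sum.map A.arrow B.arrow z) 0
      = Sum.elim A B z := by
    rintro (z | z)
    · exact past_arrow_zero A z
    · exact past_arrow_zero B z
  have h1 : ∀ (z : Fin a ⊕ Fin b) (n : ℕ),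
      Sum.elim (past A) (past B) (Sum.map A.arrow B.arrow z) (n + 1)
        = Sum.elim (past A) (past B) z n := by
    rintro (z | z) n
    · exact past_arrow_succ A z n
    · exact past_arrow_succ B z n
  refine exists_iso_ofSeq (X := (ofSeq A).sum (ofSeq B)) finSumFinEquiv key hkey ?_
  intro (x : Fin a ⊕ Fin b) (y : Fin a ⊕ Fin b) hxy
  change Sum.elim A B x < Sum.elim A B y ∨ (Sum.elim A B x = Sum.elim A B y ∧ key x < key y) at hxy
  change key (Sum.map A.arrow B.arrow x) < key (Sum.map A.arrow B.arrow y)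
  rw [Prod.Lex.lt_iff]
  rcases hxy with h | ⟨h, h'⟩
  · exact Or.inl (toLex_lt_toLex_of_shift (h1 x) (h1 y) (Or.inl (by rwa [h0, h0])))
  · rw [Prod.Lex.lt_iff] at h'
    rcases h' with h' | ⟨h', h''⟩
    · exact Or.inl (toLex_lt_toLex_of_shift (h1 x) (h1 y) (Or.inr ⟨by rw [h0, h0, h], h'⟩))
    · right
      refine ⟨?_, ?_⟩
      · change toLex _ = toLex _
        congr 1
        funext n
        cases n with
        | zero => rw [h0, h0, h]
        | succ n => rw [h1, h1]; exact congrFun (toLex.injective h') n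
      · change toLex x < toLex y at h''
        change toLex (Sum.map A.arrow B.arrow x) < toLex (Sum.map A.arrow B.arrow y)
        rcases x with x | x <;> rcases y with y | y
        · exact Sum.Lex.inl_lt_inl_iff.2
            (arrow_lt_arrow A (Or.inr ⟨h, Sum.Lex.inl_lt_inl_iff.1 h''⟩))
        · exact Sum.Lex.inl_lt_inr _ _
        · exact absurd h'' (Sum.Lex.not_inr_lt_inl)
        · exact Sum.Lex.inr_lt_inr_iff.2
            (arrow_lt_arrow B (Or.inr ⟨h, Sum.Lex.inr_lt_inr_iff.1 h''⟩))

end LabelledMap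

namespace LabelledMap

/-! ### Splitting off an invariant set of positions -/

theorem iso_ofList_of_eq {h : ℕ} (A : ZeroOneSeq h) {l : List (Fin 2)} (hl : List.ofFn A = l) :
    Iso (ofSeq A) (ofList l) := hl ▸ ofSeq_iso_ofList_ofFn A

/-- The restriction of the labelled self-map of a sequence to an invariant set of positions. -/
def restrict {h : ℕ} (A : ZeroOneSeq h) (I : List (Fin h)) (hI : ∀ i ∈ I, A.arrow i ∈ I) :
    LabelledMap where
  carrier := {x // x ∈ I}
  map := fun x => ⟨A.arrow x, hI _ x.2⟩
  label := fun x => A x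

/-- The monotonicity that characterises arrows passes to an invariant subset with the induced order.
-/
theorem restrict_iso {h : ℕ} (A : ZeroOneSeq h) (I : List (Fin h)) (hI : ∀ i ∈ I, A.arrow i ∈ I)
    (hs : I.SortedLT) : Iso (restrict A I hI) (ofList (I.map A)) := by
  refine (iso_ofSeq (fun k : Fin I.length => A (I.get k)) (hs.getIso I).symm.toEquiv
    (fun x => ?_) fun x y hxy => ?_).trans (iso_ofList_of_eq _ ?_)
  · have := hs.coe_getIso_apply (i := (hs.getIso I).symm x)
    exact congrArg A (this.symm.trans (congrArg Subtype.val ((hs.getIso I).apply_symm_apply x)))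
  · refine (hs.getIso I).symm.lt_iff_lt.2 ?_
    refine arrow_lt_arrow A ?_
    rcases hxy with h | ⟨h, h'⟩
    · exact Or.inl h
    · exact Or.inr ⟨h, (hs.getIso I).symm.lt_iff_lt.1 h'⟩
  · conv_rhs => rw [← List.map_get_finRange I, List.map_map]
    rw [List.ofFn_eq_map]
    rfl

/-- The arrow sends the `k`-th position in sorted order (the list `J`) to position `k`. Equality of
the colour patterns in sorted order and in order of position therefore makes colour constant along
arrows. -/
theorem color_arrow {L : List (Fin 2 × Bool)}
    (hL : (L.filter (fun x => x.1 = 0) ++ L.filter (fun x => x.1 = 1)).map Prod.snd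
      = L.map Prod.snd) (i : Fin L.length) :
    (L.get (ZeroOneSeq.arrow (fun i => (L.get i).1) i)).2 = (L.get i).2 := by
  set A : ZeroOneSeq L.length := fun i => (L.get i).1 with hA
  set J := (List.finRange L.length).filter (fun i => A i = 0)
    ++ (List.finRange L.length).filter (fun i => A i = 1) with hJ
  have hfin : ∀ x : Fin 2, L.filter (fun y => y.1 = x)
      = ((List.finRange L.length).filter (fun i => A i = x)).map L.get := by
    intro x
    conv_lhs => rw [← List.map_get_finRange L]
    rw [List.filter_map]
    rfl
  have hJmap : J.map (fun i => (L.get i).2) = L.map Prod.snd := by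
    rw [← hL, hfin, hfin, hJ, List.map_append, List.map_append, List.map_map, List.map_map]
    rfl
  have hlen : J.length = L.length := by simpa using congrArg List.length hJmap
  have hpair : J.Pairwise fun i j => A i < A j ∨ (A i = A j ∧ i < j) := by
    have hf : ∀ x, ((List.finRange L.length).filter (fun i => A i = x)).Pairwise
        fun i j => A i < A j ∨ (A i = A j ∧ i < j) := by
      intro x
      refine List.Pairwise.imp_of_mem ?_
        ((List.pairwise_lt_finRange L.length).sublist List.filter_sublist)
      intro i j hi hj hij
      simp only [List.mem_filter, decide_eq_true_eq] at hi hj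
      exact Or.inr ⟨hi.2.trans hj.2.symm, hij⟩
    refine List.pairwise_append.2 ⟨hf 0, hf 1, fun i hi j hj => ?_⟩
    simp only [List.mem_filter, decide_eq_true_eq] at hi hj
    left
    rw [hi.2, hj.2]
    decide
  have harrow := arrow_comp_eq A hlen J.get (fun i j hij => by
    exact List.pairwise_iff_get.1 hpair i j hij)
  have hmem : i ∈ J := by
    rw [hJ]
    simp only [List.mem_append, List.mem_filter, List.mem_finRange, true_and, decide_eq_true_eq]
    omega
  obtain ⟨k, rfl⟩ := List.mem_iff_get.1 hmem
  rw [harrow k]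
  have h1 : (J.map (fun i => (L.get i).2))[k.1]? = (L.map Prod.snd)[k.1]? := by rw [hJmap]
  have hk : k.1 < L.length := by have := k.2; omega
  simp only [List.getElem?_map, List.getElem?_eq_getElem k.2, List.getElem?_eq_getElem hk,
    Option.map_some, Option.some.injEq] at h1
  exact h1.symm

/-- If the colours of the positions are compatible with sorting by labels, then the labelled
self-map of the list decomposes by colours. -/
theorem ofList_iso_sum_of_color (L : List (Fin 2 × Bool))
    (hL : (L.filter (fun x => x.1 = 0) ++ L.filter (fun x => x.1 = 1)).map Prod.snd
      = L.map Prod.snd) :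
    Iso (ofList (L.map Prod.fst))
      ((ofList ((L.filter fun x => x.2).map Prod.fst)).sum
        (ofList ((L.filter fun x => !x.2).map Prod.fst))) := by
  set A : ZeroOneSeq L.length := fun i => (L.get i).1 with hA
  have hcol := color_arrow hL
  have h0 : Iso (ofSeq A) (ofList (L.map Prod.fst)) := by
    refine iso_ofList_of_eq _ ?_
    conv_rhs => rw [← List.map_get_finRange L, List.map_map]
    rw [List.ofFn_eq_map]
    rfl
  have hsub : ∀ (f : Fin 2 × Bool → Bool) (hf : ∀ x y, x.2 = y.2 → f x = f y),
      ∃ hI, Iso (restrict A ((List.finRange L.length).filter fun i => f (L.get i)) hI)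
        (ofList ((L.filter f).map Prod.fst)) := by
    intro f hf
    refine ⟨fun i hi => ?_, ?_⟩
    · simp only [List.mem_filter, List.mem_finRange, true_and] at hi ⊢
      rw [← hi]
      exact hf _ _ (hcol i)
    · have heq : (L.filter f).map Prod.fst
          = ((List.finRange L.length).filter fun i => f (L.get i)).map A := by
        conv_lhs => rw [← List.map_get_finRange L]
        rw [List.filter_map, List.map_map]
        rfl
      rw [heq]
      exact restrict_iso A _ _ ((List.sortedLT_finRange _).pairwise.sublist
        List.filter_sublist).sortedLT
  obtain ⟨hI, h1⟩ := hsub (fun x => x.2) (fun x y h => h)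
  obtain ⟨hI', h2⟩ := hsub (fun x => !x.2) (fun x y h => by rw [h])
  refine h0.symm.trans (Iso.trans (Iso.symm ?_) (h1.sum h2))
  have hor : ∀ i : Fin L.length, (i ∈ (List.finRange L.length).filter fun i => (L.get i).2) ↔
      (L.get i).2 = true := by simp
  have hor' : ∀ i : Fin L.length, (i ∈ (List.finRange L.length).filter fun i => !(L.get i).2) ↔
      ¬ ((L.get i).2 = true) := by simp
  refine ⟨(Equiv.sumCongr (Equiv.subtypeEquivRight hor) (Equiv.subtypeEquivRight hor')).trans
    (Equiv.sumCompl _), ?_, ?_⟩ <;> rintro (x | x) <;> rfl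

/-! ### Substitutions -/

/-- Insert a point with label `x` after each point with label `y`. -/
def insertAfter (y x : Fin 2) (X : LabelledMap) : LabelledMap where
  carrier := X.carrier ⊕ {z // X.label z = y}
  map := Sum.elim (fun z => if h : X.label z = y then Sum.inr ⟨z, h⟩ else Sum.inl (X.map z))
    fun z => Sum.inl (X.map z)
  label := Sum.elim X.label fun _ => x

theorem insertAfter_map_of_eq {X : LabelledMap} {y : Fin 2} (x : Fin 2) {z : X.carrier}
    (h : X.label z = y) : (X.insertAfter y x).map (Sum.inl z) = Sum.inr ⟨z, h⟩ := dif_pos h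

theorem insertAfter_map_of_ne {X : LabelledMap} {y : Fin 2} (x : Fin 2) {z : X.carrier}
    (h : X.label z ≠ y) : (X.insertAfter y x).map (Sum.inl z) = Sum.inl (X.map z) := dif_neg h

theorem Iso.insertAfter {X Y : LabelledMap} (y x : Fin 2) (h : Iso X Y) :
    Iso (X.insertAfter y x) (Y.insertAfter y x) := by
  obtain ⟨e, h1, h2⟩ := h
  refine ⟨Equiv.sumCongr e (e.subtypeEquiv fun z => by rw [h1]), ?_, ?_⟩
  · rintro (z | z)
    · exact h1 z
    · rfl
  · rintro (z | z)
    · by_cases hz : X.label z = y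
      · exact (congrArg _ (insertAfter_map_of_eq x hz)).trans
          (insertAfter_map_of_eq x ((h1 z).trans hz)).symm
      · refine (congrArg _ (insertAfter_map_of_ne x hz)).trans
          (Eq.trans ?_ (insertAfter_map_of_ne x (by rwa [h1])).symm)
        exact congrArg Sum.inl (h2 z)
    · exact congrArg Sum.inl (h2 z)

theorem insertAfter_sum (y x : Fin 2) (X Y : LabelledMap) :
    Iso ((X.sum Y).insertAfter y x) ((X.insertAfter y x).sum (Y.insertAfter y x)) := by
  refine Iso.symm ⟨⟨
    Sum.elim (Sum.elim (fun z => Sum.inl (Sum.inl z)) fun z => Sum.inr ⟨Sum.inl z.1, z.2⟩)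
      (Sum.elim (fun z => Sum.inl (Sum.inr z)) fun z => Sum.inr ⟨Sum.inr z.1, z.2⟩),
    fun z => match z with
      | Sum.inl (Sum.inl z) => Sum.inl (Sum.inl z)
      | Sum.inl (Sum.inr z) => Sum.inr (Sum.inl z)
      | Sum.inr ⟨Sum.inl z, h⟩ => Sum.inl (Sum.inr ⟨z, h⟩)
      | Sum.inr ⟨Sum.inr z, h⟩ => Sum.inr (Sum.inr ⟨z, h⟩), ?_, ?_⟩, ?_, ?_⟩
  · rintro ((z | z) | (z | z)) <;> rfl
  · rintro ((z | z) | ⟨(z | z), h⟩) <;> rfl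
  · rintro ((z | z) | (z | z)) <;> rfl
  · rintro ((z | z) | (z | z))
    · by_cases hz : X.label z = y
      · exact (congrArg _ (congrArg Sum.inl (insertAfter_map_of_eq x hz))).trans
          (insertAfter_map_of_eq (X := X.sum Y) (z := Sum.inl z) x hz).symm
      · exact (congrArg _ (congrArg Sum.inl (insertAfter_map_of_ne x hz))).trans
          (insertAfter_map_of_ne (X := X.sum Y) (z := Sum.inl z) x hz).symm
    · rfl
    · by_cases hz : Y.label z = y
      · exact (congrArg _ (congrArg Sum.inr (insertAfter_map_of_eq x hz))).trans
          (insertAfter_map_of_eq (X := X.sum Y) (z := Sum.inr z) x hz).symm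
      · exact (congrArg _ (congrArg Sum.inr (insertAfter_map_of_ne x hz))).trans
          (insertAfter_map_of_ne (X := X.sum Y) (z := Sum.inr z) x hz).symm
    · rfl

theorem card_label (l : List (Fin 2)) (x : Fin 2) :
    ZeroOneSeq.count (h := l.length) l.get x = l.count x := by
  have h1 : l.count x = ((List.finRange l.length).filter fun i => l.get i = x).length := by
    conv_lhs => rw [← List.map_get_finRange l]
    rw [List.count_eq_length_filter, List.filter_map, List.length_map]
    refine congrArg _ (List.filter_congr ?_)
    exact fun i _ => beq_eq_decide _ _
  rw [h1]
  rfl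

theorem count_zero_add_count_one (l : List (Fin 2)) : l.count 0 + l.count 1 = l.length := by
  rw [← card_label, ← card_label]
  exact ZeroOneSeq.count_zero_add_count_one _

theorem iso_ofList {X : LabelledMap} {l : List (Fin 2)} (f : X.carrier → ℕ)
    (hf : Function.Injective f) (hlt : ∀ x, f x < l.length) (e : X.carrier ≃ Fin l.length)
    (hlabel : ∀ x, l[f x]? = some (X.label x))
    (hmap : ∀ x y, X.label x < X.label y ∨ (X.label x = X.label y ∧ f x < f y) →
      f (X.map x) < f (X.map y)) : Iso X (ofList l) := by
  have : Finite X.carrier := Finite.of_equiv _ e.symm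
  let g : X.carrier → Fin l.length := fun x => ⟨f x, hlt x⟩
  have hg : Function.Injective g := fun x y hxy => hf (congrArg Fin.val hxy)
  have hsurj : Function.Surjective g := by
    have : Function.Injective (g ∘ e.symm) := hg.comp e.symm.injective
    have := (Finite.injective_iff_surjective.1 this)
    exact this.of_comp
  refine iso_ofSeq _ (Equiv.ofBijective g ⟨hg, hsurj⟩) (fun x => ?_) hmap
  have := hlabel x
  rw [List.getElem?_eq_getElem (hlt x)] at this
  exact Option.some.inj this

/-- The point inserted after a zero `z` takes the place `A.arrow z`, among the first `count 0`
places, and each old position moves up by `count 0`. -/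
theorem insertAfter_zero_iso (l : List (Fin 2)) :
    Iso ((ofList l).insertAfter 0 1) (ofList (List.replicate (l.count 0) 1 ++ l)) := by
  set A : ZeroOneSeq l.length := l.get with hA
  have hv : A.count 0 = l.count 0 := card_label l 0
  have hz : ∀ i : Fin l.length, A i = 0 → (A.arrow i : ℕ) < l.count 0 := by
    intro i hi
    have := A.countBelow_lt_count i
    rw [hi] at this
    simpa [ZeroOneSeq.arrow, hi, ← hv] using this
  have ho : ∀ i : Fin l.length, A i ≠ 0 → l.count 0 ≤ (A.arrow i : ℕ) := by
    intro i hi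
    simp [ZeroOneSeq.arrow, hi, hv]
  have hcases : ∀ i, A i = 0 ∨ A i = 1 := fun i => by omega
  let f : Fin l.length ⊕ {z : Fin l.length // A z = 0} → ℕ :=
    Sum.elim (fun i => l.count 0 + i) fun z => A.arrow z.1
  have hcard : Fintype.card {z : Fin l.length // A z = 0} = l.count 0 := by
    rw [← hv, Fintype.card_subtype]
    rfl
  have e : Fin l.length ⊕ {z : Fin l.length // A z = 0} ≃
      Fin (List.replicate (l.count 0) 1 ++ l).length :=
    Fintype.equivOfCardEq (by simp [hcard]; omega)
  refine iso_ofList (X := (ofList l).insertAfter 0 1) f ?_ ?_ e ?_ ?_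
  · rintro ((i : Fin l.length) | ⟨(i : Fin l.length), hi⟩)
      ((j : Fin l.length) | ⟨(j : Fin l.length), hj⟩) hij
    · have : l.count 0 + (i : ℕ) = l.count 0 + j := hij
      exact congrArg Sum.inl (Fin.ext (by omega))
    · have : l.count 0 + (i : ℕ) = A.arrow j := hij
      have := hz j hj
      omega
    · have : (A.arrow i : ℕ) = l.count 0 + j := hij
      have := hz i hi
      omega
    · have := A.arrow_injective (Fin.ext hij)
      subst this
      rfl
  · rintro ((i : Fin l.length) | ⟨(i : Fin l.length), hi⟩)
    · have : l.count 0 + (i : ℕ) < (List.replicate (l.count 0) (1 : Fin 2) ++ l).length := by simp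
      exact this
    · have : (A.arrow i : ℕ) < (List.replicate (l.count 0) (1 : Fin 2) ++ l).length := by
        have := hz i hi
        simp only [List.length_append, List.length_replicate]
        omega
      exact this
  · rintro ((i : Fin l.length) | ⟨(i : Fin l.length), hi⟩)
    · change (List.replicate (l.count 0) (1 : Fin 2) ++ l)[l.count 0 + (i : ℕ)]? = some (A i)
      rw [List.getElem?_append_right (by simp)]
      simp [hA]
    · change (List.replicate (l.count 0) (1 : Fin 2) ++ l)[(A.arrow i : ℕ)]? = some 1
      rw [List.getElem?_append_left (by simpa using hz i hi)]
      simp [hz i hi]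
  · rintro ((i : Fin l.length) | ⟨(i : Fin l.length), hi⟩)
      ((j : Fin l.length) | ⟨(j : Fin l.length), hj⟩) hij
    · change A i < A j ∨ (A i = A j ∧ l.count 0 + (i : ℕ) < l.count 0 + j) at hij
      have hij' : A i < A j ∨ (A i = A j ∧ i < j) := by
        rcases hij with h | ⟨h, h'⟩
        · exact Or.inl h
        · exact Or.inr ⟨h, by omega⟩
      have hlt := arrow_lt_arrow A hij'
      change f (if h : A i = 0 then Sum.inr ⟨i, h⟩ else Sum.inl (A.arrow i))
        < f (if h : A j = 0 then Sum.inr ⟨j, h⟩ else Sum.inl (A.arrow j))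
      have h1 := hz i
      have h2 := hz j
      have h3 := ho j
      by_cases hi : A i = 0 <;> by_cases hj : A j = 0 <;> simp [hi, hj, f] <;> omega
    · change A i < 1 ∨ (A i = 1 ∧ l.count 0 + (i : ℕ) < A.arrow j) at hij
      have h2 := hz j hj
      have hi : A i = 0 := by
        rcases hij with h | ⟨h, h'⟩
        · omega
        · omega
      change f (if h : A i = 0 then Sum.inr ⟨i, h⟩ else Sum.inl (A.arrow i))
        < l.count 0 + (A.arrow j : ℕ)
      have := hz i hi
      simp [hi, f]
      omega
    · change 1 < A j ∨ (1 = A j ∧ (A.arrow i : ℕ) < l.count 0 + j) at hij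
      have hj : A j = 1 := by omega
      have hj0 : A j ≠ 0 := by omega
      have hlt := arrow_lt_arrow A (i := i) (j := j) (Or.inl (by rw [show A i = 0 from hi, show A j = 1 from hj]; decide))
      change l.count 0 + (A.arrow i : ℕ)
        < f (if h : A j = 0 then Sum.inr ⟨j, h⟩ else Sum.inl (A.arrow j))
      simp [hj0, f]
      omega
    · change (1 : Fin 2) < 1 ∨ ((1 : Fin 2) = 1 ∧ (A.arrow i : ℕ) < A.arrow j) at hij
      have hlt : A.arrow i < A.arrow j := by simpa using hij
      change l.count 0 + (A.arrow i : ℕ) < l.count 0 + A.arrow j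
      omega

/-- Here old positions stay, and the point inserted after a one `z` takes the place `count 1 +
A.arrow z`, beyond the end of `l`. -/
theorem insertAfter_one_iso (l : List (Fin 2)) :
    Iso ((ofList l).insertAfter 1 0) (ofList (l ++ List.replicate (l.count 1) 0)) := by
  set A : ZeroOneSeq l.length := l.get with hA
  have hv : A.count 0 = l.count 0 := card_label l 0
  have hsum := count_zero_add_count_one l
  have hz : ∀ i : Fin l.length, A i = 0 → (A.arrow i : ℕ) < l.count 0 := by
    intro i hi
    have := A.countBelow_lt_count i
    rw [hi] at this
    simpa [ZeroOneSeq.arrow, hi, ← hv] using this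
  have ho : ∀ i : Fin l.length, A i = 1 → l.count 0 ≤ (A.arrow i : ℕ) := by
    intro i hi
    simp [ZeroOneSeq.arrow, hi, hv]
  have hcases : ∀ i, A i = 0 ∨ A i = 1 := fun i => by omega
  let f : Fin l.length ⊕ {z : Fin l.length // A z = 1} → ℕ :=
    Sum.elim (fun i => i) fun z => l.count 1 + A.arrow z.1
  have hcard : Fintype.card {z : Fin l.length // A z = 1} = l.count 1 := by
    rw [← card_label l 1, Fintype.card_subtype]
    rfl
  have e : Fin l.length ⊕ {z : Fin l.length // A z = 1} ≃
      Fin (l ++ List.replicate (l.count 1) 0).length :=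
    Fintype.equivOfCardEq (by simp [hcard])
  refine iso_ofList (X := (ofList l).insertAfter 1 0) f ?_ ?_ e ?_ ?_
  · rintro ((i : Fin l.length) | ⟨(i : Fin l.length), hi⟩)
      ((j : Fin l.length) | ⟨(j : Fin l.length), hj⟩) hij
    · exact congrArg Sum.inl (Fin.ext hij)
    · have : (i : ℕ) = l.count 1 + A.arrow j := hij
      have := ho j hj
      omega
    · have : l.count 1 + (A.arrow i : ℕ) = j := hij
      have := ho i hi
      omega
    · have h1 : l.count 1 + (A.arrow i : ℕ) = l.count 1 + A.arrow j := hij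
      have := A.arrow_injective (Fin.ext (by omega : (A.arrow i : ℕ) = A.arrow j))
      subst this
      rfl
  · rintro ((i : Fin l.length) | ⟨(i : Fin l.length), hi⟩)
    · have : (i : ℕ) < (l ++ List.replicate (l.count 1) (0 : Fin 2)).length := by simp; omega
      exact this
    · have : l.count 1 + (A.arrow i : ℕ) < (l ++ List.replicate (l.count 1) (0 : Fin 2)).length := by
        simp only [List.length_append, List.length_replicate]
        omega
      exact this
  · rintro ((i : Fin l.length) | ⟨(i : Fin l.length), hi⟩)
    · change (l ++ List.replicate (l.count 1) (0 : Fin 2))[(i : ℕ)]? = some (A i)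
      rw [List.getElem?_append_left i.2]
      simp [hA]
    · change (l ++ List.replicate (l.count 1) (0 : Fin 2))[l.count 1 + (A.arrow i : ℕ)]? = some 0
      have := ho i hi
      rw [List.getElem?_append_right (by omega), List.getElem?_replicate_of_lt (by omega)]
  · rintro ((i : Fin l.length) | ⟨(i : Fin l.length), hi⟩)
      ((j : Fin l.length) | ⟨(j : Fin l.length), hj⟩) hij
    · change A i < A j ∨ (A i = A j ∧ (i : ℕ) < j) at hij
      have hlt := arrow_lt_arrow A hij
      change f (if h : A i = 1 then Sum.inr ⟨i, h⟩ else Sum.inl (A.arrow i))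
        < f (if h : A j = 1 then Sum.inr ⟨j, h⟩ else Sum.inl (A.arrow j))
      have h2 := ho j
      by_cases hi : A i = 1 <;> by_cases hj : A j = 1 <;> simp [hi, hj, f] <;> omega
    · change A i < 0 ∨ (A i = 0 ∧ (i : ℕ) < l.count 1 + A.arrow j) at hij
      have hi : A i = 0 := by omega
      have hi1 : A i ≠ 1 := by omega
      have hlt := arrow_lt_arrow A (i := i) (j := j) (Or.inl (by rw [show A i = 0 from hi, show A j = 1 from hj]; decide))
      change f (if h : A i = 1 then Sum.inr ⟨i, h⟩ else Sum.inl (A.arrow i)) < (A.arrow j : ℕ)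
      simpa [hi1, f] using hlt
    · change 0 < A j ∨ (0 = A j ∧ l.count 1 + (A.arrow i : ℕ) < j) at hij
      have h1 := ho i hi
      have hj : A j = 1 := by
        rcases hij with h | ⟨h, h'⟩
        · omega
        · omega
      have h2 := ho j hj
      change (A.arrow i : ℕ) < f (if h : A j = 1 then Sum.inr ⟨j, h⟩ else Sum.inl (A.arrow j))
      simp [hj, f]
      omega
    · change (0 : Fin 2) < 0 ∨ ((0 : Fin 2) = 0 ∧
        l.count 1 + (A.arrow i : ℕ) < l.count 1 + A.arrow j) at hij
      have hlt : l.count 1 + (A.arrow i : ℕ) < l.count 1 + A.arrow j := by simpa using hij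
      change (A.arrow i : ℕ) < A.arrow j
      omega

end LabelledMap

namespace LabelledMap

/-! ### Elementary steps and chains -/

/-- `X` is constructed from `Y` by exchanging `0 1` for `1 0` in a direct summand. -/
def Step (X Y : LabelledMap) : Prop :=
  ∃ r s t : List (Fin 2), Iso X ((ofList r).sum (ofList (s ++ 1 :: 0 :: t))) ∧
    Iso Y ((ofList r).sum (ofList (s ++ 0 :: 1 :: t)))

/-- `Chain n X Y`: there is a chain of `n` elementary steps from `X` to `Y`. -/
inductive Chain : ℕ → LabelledMap → LabelledMap → Prop
  | nil {X Y : LabelledMap} : Iso X Y → Chain 0 X Y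
  | cons {n : ℕ} {X Y Z : LabelledMap} : Step X Y → Chain n Y Z → Chain (n + 1) X Z

/-- `X` is the labelled self-map of a sequence. -/
def IsSeq (X : LabelledMap) : Prop := ∃ l, Iso X (ofList l)

theorem isSeq_ofList (l : List (Fin 2)) : IsSeq (ofList l) := ⟨l, Iso.refl _⟩

theorem isSeq_of_iso_ofSeq {X : LabelledMap} {h : ℕ} {A : ZeroOneSeq h} (hX : Iso X (ofSeq A)) :
    IsSeq X := ⟨_, hX.trans (ofSeq_iso_ofList_ofFn A)⟩

theorem IsSeq.sum {X Y : LabelledMap} : IsSeq X → IsSeq Y → IsSeq (X.sum Y) := by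
  rintro ⟨l, hl⟩ ⟨l', hl'⟩
  obtain ⟨C, hC⟩ := exists_sum_iso_ofSeq (a := l.length) (b := l'.length) l.get l'.get
  exact isSeq_of_iso_ofSeq ((hl.sum hl').trans hC)

theorem isSeq_empty : IsSeq empty :=
  ⟨[], ⟨Equiv.equivOfIsEmpty Empty (Fin 0), fun x => x.elim, fun x => x.elim⟩⟩

theorem Step.of_iso {X X' Y Y' : LabelledMap} (h : Step X Y) (hX : Iso X' X) (hY : Iso Y' Y) :
    Step X' Y' := by
  obtain ⟨r, s, t, h1, h2⟩ := h
  exact ⟨r, s, t, hX.trans h1, hY.trans h2⟩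

theorem step_exchange (s t : List (Fin 2)) :
    Step (ofList (s ++ 1 :: 0 :: t)) (ofList (s ++ 0 :: 1 :: t)) := by
  have he : ∀ X, Iso X ((ofList []).sum X) := fun X =>
    (empty_sum X).symm.trans (Iso.sum ⟨Equiv.equivOfIsEmpty Empty (Fin 0), fun x => x.elim,
      fun x => x.elim⟩ (Iso.refl X))
  exact ⟨[], s, t, he _, he _⟩

/-- The spectator summand of a step has to be a sequence, so `R` is merged with the old spectator
`r` into a single one. -/
theorem Step.add_left {X Y R : LabelledMap} (hR : IsSeq R) (h : Step X Y) :
    Step (R.sum X) (R.sum Y) := by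
  obtain ⟨r, s, t, h1, h2⟩ := h
  obtain ⟨q, hq⟩ := hR.sum (isSeq_ofList r)
  exact ⟨q, s, t, (((Iso.refl R).sum h1).trans (sum_assoc _ _ _).symm).trans (hq.sum (Iso.refl _)),
    (((Iso.refl R).sum h2).trans (sum_assoc _ _ _).symm).trans (hq.sum (Iso.refl _))⟩

theorem Chain.of_iso {n : ℕ} {X X' Y Y' : LabelledMap} (h : Chain n X Y) (hX : Iso X' X)
    (hY : Iso Y' Y) : Chain n X' Y' := by
  induction h generalizing X' with
  | nil h => exact .nil ((hX.trans h).trans hY.symm)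
  | cons h _ ih => exact .cons (h.of_iso hX (Iso.refl _)) (ih (Iso.refl _) hY)

theorem Chain.trans {m n : ℕ} {X Y Z : LabelledMap} (h : Chain m X Y) (h' : Chain n Y Z) :
    Chain (m + n) X Z := by
  induction h with
  | nil h => simpa using h'.of_iso h (Iso.refl _)
  | cons h _ ih => exact Nat.add_right_comm _ _ _ ▸ .cons h (ih h')

theorem Chain.snoc {n : ℕ} {X Y Z : LabelledMap} (h : Chain n X Y) (h' : Step Y Z) :
    Chain (n + 1) X Z := h.trans (.cons h' (.nil (Iso.refl _)))

theorem Chain.add_left {n : ℕ} {X Y R : LabelledMap} (hR : IsSeq R) (h : Chain n X Y) :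
    Chain n (R.sum X) (R.sum Y) := by
  induction h with
  | nil h => exact .nil ((Iso.refl R).sum h)
  | cons h _ ih => exact .cons (h.add_left hR) ih

/-- The substitution only prepends ones, equally many on both sides because an exchange keeps the
number of zeros. The exchanged pair survives. -/
theorem Step.insertAfter_zero {X Y : LabelledMap} (h : Step X Y) :
    Step (X.insertAfter 0 1) (Y.insertAfter 0 1) := by
  obtain ⟨r, s, t, h1, h2⟩ := h
  refine ⟨_, List.replicate ((s ++ 1 :: 0 :: t).count 0) 1 ++ s, t,
    ((h1.insertAfter 0 1).trans (insertAfter_sum 0 1 _ _)).trans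
      ((insertAfter_zero_iso r).sum ?_),
    ((h2.insertAfter 0 1).trans (insertAfter_sum 0 1 _ _)).trans
      ((insertAfter_zero_iso r).sum ?_)⟩
  · rw [List.append_assoc]
    exact insertAfter_zero_iso _
  · have : (s ++ 1 :: 0 :: t).count 0 = (s ++ 0 :: 1 :: t).count 0 := by simp
    rw [List.append_assoc, this]
    exact insertAfter_zero_iso _

theorem Step.insertAfter_one {X Y : LabelledMap} (h : Step X Y) :
    Step (X.insertAfter 1 0) (Y.insertAfter 1 0) := by
  obtain ⟨r, s, t, h1, h2⟩ := h
  refine ⟨_, s, t ++ List.replicate ((s ++ 1 :: 0 :: t).count 1) 0,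
    ((h1.insertAfter 1 0).trans (insertAfter_sum 1 0 _ _)).trans
      ((insertAfter_one_iso r).sum ?_),
    ((h2.insertAfter 1 0).trans (insertAfter_sum 1 0 _ _)).trans
      ((insertAfter_one_iso r).sum ?_)⟩
  · have := insertAfter_one_iso (s ++ 1 :: 0 :: t)
    rw [List.append_assoc] at this
    exact this
  · have h3 : (s ++ 1 :: 0 :: t).count 1 = (s ++ 0 :: 1 :: t).count 1 := by simp
    have := insertAfter_one_iso (s ++ 0 :: 1 :: t)
    rw [List.append_assoc] at this
    rw [h3]
    exact this

theorem Chain.insertAfter_zero {n : ℕ} {X Y : LabelledMap} (h : Chain n X Y) :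
    Chain n (X.insertAfter 0 1) (Y.insertAfter 0 1) := by
  induction h with
  | nil h => exact .nil (h.insertAfter 0 1)
  | cons h _ ih => exact .cons h.insertAfter_zero ih

theorem Chain.insertAfter_one {n : ℕ} {X Y : LabelledMap} (h : Chain n X Y) :
    Chain n (X.insertAfter 1 0) (Y.insertAfter 1 0) := by
  induction h with
  | nil h => exact .nil (h.insertAfter 1 0)
  | cons h _ ih => exact .cons h.insertAfter_one ih

/-! ### Sums of simple sequences -/

/-- The labelled self-map of the sequence of `m` ones followed by `n` zeros. -/
def simple (s : ℕ × ℕ) : LabelledMap := ofList (List.replicate s.1 1 ++ List.replicate s.2 0)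

/-- The disjoint union of the labelled self-maps of the simple sequences of a list of pairs. -/
def simpleSum : List (ℕ × ℕ) → LabelledMap
  | [] => empty
  | s :: l => (simple s).sum (simpleSum l)

theorem isSeq_simple (s : ℕ × ℕ) : IsSeq (simple s) := isSeq_ofList _

theorem isSeq_simpleSum (l : List (ℕ × ℕ)) : IsSeq (simpleSum l) := by
  induction l with
  | nil => exact isSeq_empty
  | cons s l ih => exact (isSeq_simple s).sum ih

theorem simpleSum_append (l l' : List (ℕ × ℕ)) :
    Iso (simpleSum (l ++ l')) ((simpleSum l).sum (simpleSum l')) := by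
  induction l with
  | nil => exact (empty_sum _).symm
  | cons s l ih => exact ((Iso.refl _).sum ih).trans (sum_assoc _ _ _).symm

/-- On simple sequences the substitutions act as the two shears of Euclid's algorithm. -/
theorem simple_insertAfter_zero (m n : ℕ) :
    Iso ((simple (m, n)).insertAfter 0 1) (simple (m + n, n)) := by
  have := insertAfter_zero_iso (List.replicate m 1 ++ List.replicate n 0)
  simp only [List.count_append, List.count_replicate, beq_self_eq_true, if_true] at this
  simp only [simple]
  rw [show m + n = n + m from Nat.add_comm _ _, List.replicate_add, List.append_assoc]
  simpa using this

theorem simple_insertAfter_one (m n : ℕ) :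
    Iso ((simple (m, n)).insertAfter 1 0) (simple (m, m + n)) := by
  have := insertAfter_one_iso (List.replicate m 1 ++ List.replicate n 0)
  simp only [List.count_append, List.count_replicate, beq_self_eq_true, if_true] at this
  simp only [simple]
  rw [show m + n = n + m from Nat.add_comm _ _, List.replicate_add, ← List.append_assoc]
  simpa using this

theorem simpleSum_insertAfter_zero (l : List (ℕ × ℕ)) :
    Iso ((simpleSum l).insertAfter 0 1) (simpleSum (l.map fun s => (s.1 + s.2, s.2))) := by
  induction l with
  | nil => exact ⟨Equiv.equivOfIsEmpty (Empty ⊕ {z : Empty // _}) Empty,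
      fun x => (isEmptyElim (α := Empty ⊕ {z : Empty // _}) x),
      fun x => (isEmptyElim (α := Empty ⊕ {z : Empty // _}) x)⟩
  | cons s l ih => exact (insertAfter_sum 0 1 _ _).trans ((simple_insertAfter_zero s.1 s.2).sum ih)

theorem simpleSum_insertAfter_one (l : List (ℕ × ℕ)) :
    Iso ((simpleSum l).insertAfter 1 0) (simpleSum (l.map fun s => (s.1, s.1 + s.2))) := by
  induction l with
  | nil => exact ⟨Equiv.equivOfIsEmpty (Empty ⊕ {z : Empty // _}) Empty,
      fun x => (isEmptyElim (α := Empty ⊕ {z : Empty // _}) x),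
      fun x => (isEmptyElim (α := Empty ⊕ {z : Empty // _}) x)⟩
  | cons s l ih => exact (insertAfter_sum 1 0 _ _).trans ((simple_insertAfter_one s.1 s.2).sum ih)

end LabelledMap

/-! ### A rotation-invariant colouring with one defect -/

theorem exists_farey (m n : ℕ) (hm : 1 ≤ m) (hn : 1 ≤ n) (hmn : Nat.Coprime m n) :
    ∃ fm fn : ℕ, fm ≤ m ∧ fn ≤ n ∧ m * fn = n * fm + 1 := by
  -- `fn` is the inverse of `m` modulo `n`; modulo 1 no residue equals 1, so `n = 1` is treated
  -- separately.
  rcases Nat.lt_or_ge n 2 with h | h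
  · obtain rfl : n = 1 := by omega
    exact ⟨m - 1, 1, by omega, le_rfl, by omega⟩
  · obtain ⟨x, hx1, hx2⟩ := Nat.exists_mul_mod_eq_one_of_coprime hmn (by omega)
    have hdiv := Nat.div_add_mod (m * x) n
    rw [hx2] at hdiv
    refine ⟨m * x / n, x, ?_, hx1.le, hdiv.symm⟩
    refine Nat.div_le_of_le_mul ?_
    rw [mul_comm n]
    exact Nat.mul_le_mul_left _ hx1.le

/-- The correction at multiples of `h` is the source of the single defect in the colouring below. -/
theorem int_sub_one_ediv {h : ℤ} (hh : 0 < h) (x : ℤ) :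
    (x - 1) / h = x / h - if h ∣ x then 1 else 0 := by
  split_ifs with hx
  · obtain ⟨y, rfl⟩ := hx
    rw [Int.mul_ediv_cancel_left _ hh.ne', show h * y - 1 = (h - 1) + h * (y - 1) by ring,
      Int.add_mul_ediv_left _ _ hh.ne', Int.ediv_eq_zero_of_lt (by omega) (by omega)]
    ring
  · have h1 := Int.emod_add_mul_ediv x h
    have h2 := Int.emod_nonneg x hh.ne'
    have h3 := Int.emod_lt_of_pos x hh
    have h4 : x % h ≠ 0 := fun h0 => hx (Int.dvd_of_emod_eq_zero h0)
    rw [sub_zero, show x - 1 = (x % h - 1) + h * (x / h) by linarith,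
      Int.add_mul_ediv_left _ _ hh.ne', Int.ediv_eq_zero_of_lt (by omega) (by omega), zero_add]

/-- The list of colours of the positions `a, …, a + n - 1`. -/
def colors (c : ℕ → Bool) (a n : ℕ) : List Bool := (List.range' a n).map c

theorem length_colors (c : ℕ → Bool) (a n : ℕ) : (colors c a n).length = n := by simp [colors]

theorem colors_add (c : ℕ → Bool) (a n n' : ℕ) :
    colors c a (n + n') = colors c a n ++ colors c (a + n) n' := by
  rw [colors, ← List.range'_append_1, List.map_append]
  rfl

theorem colors_one (c : ℕ → Bool) (a : ℕ) : colors c a 1 = [c a] := rfl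

theorem colors_congr {c c' : ℕ → Bool} {a n : ℕ} (h : ∀ i, a ≤ i → i < a + n → c i = c' i) :
    colors c a n = colors c' a n := by
  refine List.map_congr_left fun i hi => ?_
  rw [List.mem_range'_1] at hi
  exact h i hi.1 hi.2

/-- The colours with the two colours at the positions `i₀` and `i₀ + 1` exchanged, if the first
one is `true` and the second one is `false`. -/
def exchangeColors (c : ℕ → Bool) (i₀ i : ℕ) : Bool :=
  if i = i₀ then false else if i = i₀ + 1 then true else c i

/-- The arrow of `1^m 0^n` is translation by `n` modulo `h = m + n`. With `p = fm + fn`, colour `i`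
by the increment of `u j = ⌊j p / h⌋` from `i - i₀ - 1` to `i - i₀`. As `n p = h fn - 1`,
translation by `n` changes `u`, apart from a constant, only at multiples of `h`; hence only the
colours at `i₀` and `i₀ + 1` change, and they trade places. The condition `i₀ + 1 ≠ m` keeps this
pair inside one block of labels, as the counts require. -/
theorem exists_coloring (m n i₀ : ℕ) (hm : 1 ≤ m) (hn : 1 ≤ n) (hmn : Nat.Coprime m n)
    (hi₀ : i₀ + 1 < m + n) (hi₀' : i₀ + 1 ≠ m) :
    ∃ (c : ℕ → Bool) (fm fn : ℕ), fm ≤ m ∧ fn ≤ n ∧ m * fn = n * fm + 1 ∧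
      c i₀ = true ∧ c (i₀ + 1) = false ∧
      colors (exchangeColors c i₀) m n ++ colors (exchangeColors c i₀) 0 m = colors c 0 (m + n) ∧
      (colors c 0 m).count true = fm ∧ (colors c m n).count true = fn ∧
      (colors c 0 n).count true = fn := by
  obtain ⟨fm, fn, hfm, hfn, hF⟩ := exists_farey m n hm hn hmn
  set h : ℤ := (m : ℤ) + n with hh
  set p : ℤ := (fm : ℤ) + fn with hp
  have hpos : 0 < h := by omega
  have hF' : h * fn = n * p + 1 := by
    have : (m : ℤ) * fn = n * fm + 1 := by exact_mod_cast hF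
    rw [hh, hp]; linarith
  have hp0 : 0 ≤ p := by omega
  have hph : p ≤ h := by omega
  -- `hF'` exhibits `-n` as an inverse of `p` modulo `h`.
  have hdvd : ∀ j : ℤ, h ∣ j * p → h ∣ j := fun j hj => by
    have : j = h * (j * fn) - n * (j * p) := by linear_combination (-j) * hF'
    rw [this]
    exact dvd_sub (dvd_mul_right _ _) (Dvd.dvd.mul_left hj _)
  let u : ℤ → ℤ := fun j => j * p / h
  have hu_h : ∀ j, u (j + h) = u j + p := fun j => by
    simp only [u]
    rw [add_mul, Int.add_mul_ediv_left _ _ hpos.ne']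
  have hu_n : ∀ j, u (j + n) = u j + fn - if h ∣ j then 1 else 0 := fun j => by
    have h1 := int_sub_one_ediv hpos (j * p)
    have h2 : (if h ∣ j * p then (1 : ℤ) else 0) = if h ∣ j then 1 else 0 := by
      by_cases hj : h ∣ j
      · rw [if_pos hj, if_pos (hj.mul_right _)]
      · rw [if_neg hj, if_neg (fun h' => hj (hdvd j h'))]
    simp only [u]
    rw [show (j + n) * p = (j * p - 1) + h * fn by linarith, Int.add_mul_ediv_left _ _ hpos.ne', h1,
      h2]
    ring
  have hstep : ∀ j, u (j - 1) ≤ u j ∧ u j ≤ u (j - 1) + 1 := fun j => by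
    constructor
    · exact Int.ediv_le_ediv hpos (by nlinarith)
    · have : u (j - 1) + 1 = ((j - 1) * p + h * 1) / h :=
        (Int.add_mul_ediv_left _ _ hpos.ne').symm
      rw [this]
      exact Int.ediv_le_ediv hpos (by nlinarith)
  have hu0 : u 0 = 0 := by simp [u]
  have hp1 : 0 < p := by
    rcases hp0.eq_or_lt with h0 | h0
    · rw [← h0] at hF'
      have : h ∣ 1 := ⟨fn, by linarith⟩
      have := Int.le_of_dvd one_pos this
      omega
    · exact h0
  have hph1 : p < h := by
    rcases hph.eq_or_lt with h0 | h0
    · have : h ∣ 1 := ⟨fn - n, by rw [h0] at hF'; linarith⟩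
      have := Int.le_of_dvd one_pos this
      omega
    · exact h0
  have hu1 : u 1 = 0 := by
    simp only [u, one_mul]
    exact Int.ediv_eq_zero_of_lt hp0 hph1
  have hum1 : u (-1) = -1 := by
    simp only [u]
    rw [show (-1 : ℤ) * p = (h - p) + h * (-1) by ring, Int.add_mul_ediv_left _ _ hpos.ne',
      Int.ediv_eq_zero_of_lt (by omega) (by omega)]
    rfl
  let c : ℕ → Bool := fun i => decide (u ((i : ℤ) - i₀) - u ((i : ℤ) - i₀ - 1) = 1)
  have hc : ∀ i : ℕ, (if c i then (1 : ℤ) else 0) = u ((i : ℤ) - i₀) - u ((i : ℤ) - i₀ - 1) := by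
    intro i
    have := hstep ((i : ℤ) - i₀)
    by_cases h1 : u ((i : ℤ) - i₀) - u ((i : ℤ) - i₀ - 1) = 1
    · simp [c, h1]
    · have : u ((i : ℤ) - i₀) - u ((i : ℤ) - i₀ - 1) = 0 := by omega
      simp [c, this]
  -- Colours are increments of `u`, so their number telescopes.
  have hcount : ∀ a l : ℕ, ((colors c a l).count true : ℤ)
      = u ((a : ℤ) + l - 1 - i₀) - u ((a : ℤ) - 1 - i₀) := by
    intro a l
    induction l with
    | zero => simp [colors]
    | succ l ih =>
      rw [colors_add, List.count_append, Nat.cast_add, ih, colors_one, List.count_singleton]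
      have h1 := hc (a + l)
      push_cast at h1 ⊢
      rw [show (a : ℤ) + (l + 1) - 1 - i₀ = a + l - i₀ by ring,
        show (a : ℤ) + l - 1 - i₀ = a + l - i₀ - 1 by ring]
      cases hcl : c (a + l) <;> simp [hcl] at h1 ⊢ <;> linarith
  have hnd : ∀ j : ℤ, j ≠ 0 → -h < j → j < h → ¬ h ∣ j := by
    intro j h0 h1 h2 hj
    exact h0 (Int.eq_zero_of_abs_lt_dvd hj (abs_lt.2 ⟨h1, h2⟩))
  have hc0 : c i₀ = true := by simp [c, hu0, hum1]
  have hc1 : c (i₀ + 1) = false := by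
    simp only [c, decide_eq_false_iff_not]
    push_cast
    rw [show (i₀ : ℤ) + 1 - i₀ = 1 by ring, hu1, sub_self, hu0]
    decide
  have hrot : ∀ i : ℕ, i < m + n → ∀ k : ℕ, (k + m + n = i + n ∨ k = i + n) →
      c k = exchangeColors c i₀ i := by
    intro i hi k hk
    have hk' : u ((k : ℤ) - i₀) - u ((k : ℤ) - i₀ - 1)
        = u ((i : ℤ) - i₀ + n) - u ((i : ℤ) - i₀ - 1 + n) := by
      rcases hk with hk | hk
      · have e1 : (i : ℤ) - i₀ + n = (k - i₀) + h := by omega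
        have e2 : (i : ℤ) - i₀ - 1 + n = (k - i₀ - 1) + h := by omega
        rw [e1, e2, hu_h, hu_h]
        ring
      · have e1 : (i : ℤ) - i₀ + n = k - i₀ := by omega
        have e2 : (i : ℤ) - i₀ - 1 + n = k - i₀ - 1 := by omega
        rw [e1, e2]
    have hbool : ∀ b b' : Bool, (if b then (1 : ℤ) else 0) = (if b' then (1 : ℤ) else 0) →
        b = b' := by decide
    refine hbool _ _ ?_
    rw [hc, hk', hu_n, hu_n]
    have hci := hc i
    unfold exchangeColors
    by_cases h1 : i = i₀
    · subst h1
      rw [if_pos rfl, sub_self, if_pos (dvd_zero h), if_neg (hnd _ (by omega) (by omega) (by omega))]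
      rw [hc0, sub_self] at hci
      simp at hci ⊢
      omega
    · by_cases h2 : i = i₀ + 1
      · subst h2
        rw [if_neg h1, if_pos rfl, if_neg (hnd _ (by push_cast; omega) (by omega) (by omega))]
        rw [hc1] at hci
        push_cast at hci ⊢
        rw [show (i₀ : ℤ) + 1 - i₀ - 1 = 0 by ring] at hci ⊢
        rw [if_pos (dvd_zero h)]
        simp at hci ⊢
        omega
      · rw [if_neg h1, if_neg h2, hci, if_neg (hnd _ (by omega) (by omega) (by omega)),
          if_neg (hnd _ (by omega) (by omega) (by omega))]
        ring
  refine ⟨c, fm, fn, hfm, hfn, hF, hc0, hc1, ?_, ?_, ?_, ?_⟩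
  · rw [Nat.add_comm m n, colors_add]
    congr 1
    · refine List.ext_getElem (by simp [colors]) fun k hk _ => ?_
      simp only [colors, List.getElem_map, List.getElem_range', one_mul, zero_add]
      rw [length_colors] at hk
      exact (hrot (m + k) (by omega) k (by omega)).symm
    · refine List.ext_getElem (by simp [colors]) fun k hk _ => ?_
      simp only [colors, List.getElem_map, List.getElem_range', one_mul, zero_add]
      rw [length_colors] at hk
      exact (hrot k (by omega) (n + k) (by omega)).symm
  · have h1 := hcount 0 m
    have h2 := hu_n ((m : ℤ) - 1 - i₀)
    have h3 := hu_h ((0 : ℤ) - 1 - i₀)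
    rw [if_neg (hnd _ (by omega) (by omega) (by omega)),
      show (m : ℤ) - 1 - i₀ + n = 0 - 1 - i₀ + h by rw [hh]; ring, h3] at h2
    have : ((colors c 0 m).count true : ℤ) = fm := by
      rw [h1, show ((0 : ℕ) : ℤ) + m - 1 - i₀ = m - 1 - i₀ by push_cast; ring,
        show ((0 : ℕ) : ℤ) - 1 - i₀ = 0 - 1 - i₀ by push_cast; ring]
      linarith
    exact_mod_cast this
  · have h1 := hcount m n
    have h2 := hu_n ((m : ℤ) - 1 - i₀)
    rw [if_neg (hnd _ (by omega) (by omega) (by omega))] at h2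
    have : ((colors c m n).count true : ℤ) = fn := by
      rw [h1, show (m : ℤ) + n - 1 - i₀ = m - 1 - i₀ + n by ring, h2]
      ring
    exact_mod_cast this
  · have h1 := hcount 0 n
    have h2 := hu_n ((0 : ℤ) - 1 - i₀)
    rw [if_neg (hnd _ (by omega) (by omega) (by omega))] at h2
    have : ((colors c 0 n).count true : ℤ) = fn := by
      rw [h1, show ((0 : ℕ) : ℤ) + n - 1 - i₀ = 0 - 1 - i₀ + n by push_cast; ring,
        show ((0 : ℕ) : ℤ) - 1 - i₀ = 0 - 1 - i₀ by push_cast; ring, h2]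
      ring
    exact_mod_cast this

namespace LabelledMap

/-! ### Coloured lists -/

/-- The positions `a, …, a + n - 1`, all with label `x`, with their colours. -/
def colorSeg (c : ℕ → Bool) (x : Fin 2) (a n : ℕ) : List (Fin 2 × Bool) :=
  (colors c a n).map fun b => (x, b)

theorem colorSeg_map_fst (c : ℕ → Bool) (x : Fin 2) (a n : ℕ) :
    (colorSeg c x a n).map Prod.fst = List.replicate n x := by
  conv_rhs => rw [← length_colors c a n]
  rw [colorSeg, List.map_map]
  exact List.map_const

theorem colorSeg_map_snd (c : ℕ → Bool) (x : Fin 2) (a n : ℕ) :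
    (colorSeg c x a n).map Prod.snd = colors c a n := by
  rw [colorSeg, List.map_map]
  exact List.map_id _

theorem colorSeg_filter_fst (c : ℕ → Bool) (x y : Fin 2) (a n : ℕ) :
    (colorSeg c x a n).filter (fun z => z.1 = y) = if x = y then colorSeg c x a n else [] := by
  split_ifs with h
  · refine List.filter_eq_self.2 fun z hz => ?_
    obtain ⟨b, -, rfl⟩ := List.mem_map.1 hz
    simpa using h
  · refine List.filter_eq_nil_iff.2 fun z hz => ?_
    obtain ⟨b, -, rfl⟩ := List.mem_map.1 hz
    simpa using h

theorem colorSeg_filter_snd (c : ℕ → Bool) (x : Fin 2) (a n : ℕ) :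
    ((colorSeg c x a n).filter fun z => z.2).map Prod.fst
      = List.replicate ((colors c a n).count true) x := by
  rw [colorSeg, List.filter_map, List.map_map, List.count_eq_length_filter]
  refine List.map_const.trans ?_
  congr 2
  refine List.filter_congr fun b _ => ?_
  cases b <;> rfl

theorem colorSeg_filter_not_snd (c : ℕ → Bool) (x : Fin 2) (a n : ℕ) :
    ((colorSeg c x a n).filter fun z => !z.2).map Prod.fst
      = List.replicate (n - (colors c a n).count true) x := by
  have hlen : (colors c a n).count false = n - (colors c a n).count true := by
    have h1 := List.count_true_add_count_false (colors c a n)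
    rw [length_colors] at h1
    omega
  rw [colorSeg, List.filter_map, List.map_map, ← hlen, List.count_eq_length_filter]
  refine List.map_const.trans ?_
  congr 2
  refine List.filter_congr fun b _ => ?_
  cases b <;> rfl

theorem replicate_append_cons {α : Type} (n : ℕ) (x : α) (l : List α) :
    List.replicate n x ++ x :: l = List.replicate (n + 1) x ++ l := by
  rw [List.replicate_succ', List.append_assoc]
  rfl

theorem replicate_append_replicate {α : Type} (m n : ℕ) (x : α) (l : List α) :
    List.replicate m x ++ (List.replicate n x ++ l) = List.replicate (m + n) x ++ l := by
  rw [List.replicate_add, List.append_assoc]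

/-! ### Splitting off a simple summand by one step -/

/-- The sequence obtained by the first step from the sum of the simple sequences of
`(n + 1 + e, n)` and `(a + 1, a + b + 1)`. -/
def merged (a b n e : ℕ) : List (Fin 2) :=
  List.replicate (a + 1) 1 ++ List.replicate b 0 ++ List.replicate n 1 ++ List.replicate a 0 ++
    1 :: 0 :: (List.replicate e 1 ++ List.replicate n 0)

/-- The `n + 2 + e` ones and `n` zeros coming from the first summand are coloured with the defect at
`n, n + 1`; everything coming from the second summand is `false`. The exchange just behind the
merged pair `1 0` absorbs the defect. The `true` points form the simple summand, the others a
smaller merged sequence. -/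
theorem step_merged_of_two_le (a b n e : ℕ) (hn : 1 ≤ n) (hco : Nat.Coprime (n + 2 + e) n) :
    ∃ fm fn : ℕ, fm ≤ n + 2 + e ∧ fn ≤ n ∧ (n + 2 + e) * fn = n * fm + 1 ∧
      Step ((simple (fm, fn)).sum (ofList (merged a b (n - fn) (e + 1 + fn - fm))))
        (ofList (merged a b n (e + 1))) := by
  obtain ⟨c, fm, fn, hfm, hfn, hF, hc0, hc1, hrot, hm, hz, hz'⟩ :=
    exists_coloring (n + 2 + e) n n (by omega) hn hco (by omega) (by omega)
  have hsplit : ∀ c' : ℕ → Bool, colors c' 0 (n + 2 + e)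
      = colors c' 0 n ++ [c' n, c' (n + 1)] ++ colors c' (n + 2) e := by
    intro c'
    rw [colors_add, colors_add, Nat.zero_add, Nat.zero_add]
    rfl
  have hx0 : exchangeColors c n n = false := by simp [exchangeColors]
  have hx1 : exchangeColors c n (n + 1) = true := by simp [exchangeColors]
  have hx : ∀ i, i ≠ n → i ≠ n + 1 → exchangeColors c n i = c i := fun i h h' => by
    simp [exchangeColors, h, h']
  have hC1 : colors (exchangeColors c n) (n + 2 + e) n = colors c (n + 2 + e) n :=
    colors_congr fun i h _ => hx i (by omega) (by omega)
  have hC2 : colors (exchangeColors c n) 0 n = colors c 0 n :=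
    colors_congr fun i h _ => hx i (by omega) (by omega)
  have hC3 : colors (exchangeColors c n) (n + 2) e = colors c (n + 2) e :=
    colors_congr fun i h _ => hx i (by omega) (by omega)
  rw [colors_add c, hsplit, hsplit, hC1, hC2, hC3, hx0, hx1, hc0, hc1, Nat.zero_add] at hrot
  have hcnt : fm = fn + 1 + (colors c (n + 2) e).count true := by
    rw [← hm, hsplit, List.count_append, List.count_append, hz', hc0, hc1]
    simp
  have hle : (colors c (n + 2) e).count true ≤ e := by
    simpa [length_colors] using List.count_le_length (a := true) (l := colors c (n + 2) e)
  -- The rotation identity is cut after its first `n` entries.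
  have hswap : colors c (n + 2 + e) n = colors c 0 n ∧
      colors c 0 n ++ ([false, true] ++ colors c (n + 2) e)
        = [true, false] ++ colors c (n + 2) e ++ colors c (n + 2 + e) n := by
    refine List.append_inj ?_ (by simp [length_colors])
    simpa only [List.append_assoc] using hrot
  refine ⟨fm, fn, hfm, hfn, hF, ?_⟩
  let L : List (Fin 2 × Bool) := List.replicate (a + 1) (1, false) ++ (List.replicate b (0, false) ++
    (colorSeg c 1 0 n ++ (List.replicate a (0, false) ++ ((1, false) :: (1, true) :: (0, false) ::
      (colorSeg c 1 (n + 2) e ++ colorSeg c 0 (n + 2 + e) n)))))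
  have hiso := ofList_iso_sum_of_color L (by
    simp only [L, List.filter_append, List.filter_cons, colorSeg_filter_fst, List.map_append,
      List.filter_replicate, colorSeg_map_snd, List.map_replicate, List.map_cons]
    simp only [decide_true, decide_false, zero_ne_one, one_ne_zero, if_true, if_false,
      List.nil_append, List.append_nil, List.map_cons, List.map_replicate,
      colorSeg_map_snd, List.map_nil, Bool.false_eq_true]
    have h2 : colors c 0 n ++ false :: true :: colors c (n + 2) e
        = true :: false :: (colors c (n + 2) e ++ colors c 0 n) := by
      simpa [hswap.1] using hswap.2
    rw [hswap.1, h2]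
    simp only [List.append_assoc, replicate_append_cons,
      replicate_append_replicate]
    rw [show b + (a + 1) = a + 1 + b by omega])
  simp only [L, List.filter_append, List.filter_cons, List.map_append, List.filter_replicate,
    colorSeg_filter_snd, colorSeg_filter_not_snd, colorSeg_map_fst, List.map_replicate,
    List.map_cons, Bool.not_false, Bool.not_true, if_true, if_false, Bool.false_eq_true,
    List.nil_append, hz, hz'] at hiso
  have hstep := step_exchange (List.replicate (a + 1) 1 ++ (List.replicate b 0 ++
    (List.replicate n 1 ++ (List.replicate a 0 ++ [1])))) (List.replicate e 1 ++ List.replicate n 0)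
  simp only [List.append_assoc, List.cons_append, List.nil_append] at hstep
  have h1 : List.replicate fn (1 : Fin 2) ++ 1 :: (List.replicate ((colors c (n + 2) e).count true) 1
      ++ List.replicate fn 0) = List.replicate fm 1 ++ List.replicate fn 0 := by
    rw [replicate_append_cons, replicate_append_replicate, ← hcnt]
  rw [h1, show e - (colors c (n + 2) e).count true = e + 1 + fn - fm by omega] at hiso
  refine (hstep.of_iso hiso.symm (Iso.refl _)).of_iso ?_ ?_
  · simp only [simple, merged, List.append_assoc]
    exact Iso.refl _
  · simp only [merged, List.append_assoc, List.replicate_succ, List.cons_append]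
    exact Iso.refl _

/-- For `e = 0` only zeros follow the merged pair `1 0`, so the exchange is made where `0^(b+1)`
meets `1^(n+1)`; this is why the block of zeros must be nonempty. -/
theorem step_merged_zero (a b n : ℕ) :
    Step ((simple (1, 1)).sum (ofList (merged a (b + 1) n 0))) (ofList (merged a (b + 1) (n + 1) 0)) := by
  let L : List (Fin 2 × Bool) := List.replicate (a + 1) (1, false) ++ (List.replicate b (0, false) ++
    ((1, true) :: (0, false) :: (List.replicate n (1, false) ++ (List.replicate a (0, false) ++
      ((1, false) :: (0, true) :: List.replicate (n + 1) (0, false))))))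
  have hiso := ofList_iso_sum_of_color L (by
    simp only [L, List.filter_append, List.filter_cons, List.map_append,
      List.filter_replicate, List.map_replicate, List.map_cons]
    simp only [decide_true, decide_false, zero_ne_one, one_ne_zero, if_true, if_false,
      List.nil_append, List.map_append, List.map_cons, List.map_replicate,
      List.map_nil, Bool.false_eq_true]
    simp only [List.append_assoc, List.cons_append, replicate_append_cons,
      replicate_append_replicate]
    rw [show b + 1 + a = a + 1 + b by omega, show n + 1 + (a + 1) = n + (a + 1) + 1 by omega,
      List.replicate_succ (n := n + (a + 1)), List.cons_append, List.append_nil])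
  simp only [L, List.filter_append, List.filter_cons, List.map_append, List.filter_replicate,
    List.map_replicate,
    List.map_cons, Bool.not_false, Bool.not_true, if_true, if_false, Bool.false_eq_true,
    List.map_nil, List.nil_append] at hiso
  have hstep := step_exchange (List.replicate (a + 1) 1 ++ List.replicate b 0)
    (List.replicate n 1 ++ (List.replicate a 0 ++ 1 :: 0 :: List.replicate (n + 1) 0))
  simp only [List.append_assoc] at hstep
  refine (hstep.of_iso hiso.symm (Iso.refl _)).of_iso ?_ ?_
  · simp only [simple, merged, List.append_assoc, replicate_append_cons, List.replicate_zero,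
      List.nil_append]
    exact Iso.refl _
  · simp only [merged, List.append_assoc, List.replicate_succ' (n := b), List.replicate_succ (n := n),
      List.cons_append, List.replicate_zero, List.nil_append]
    exact Iso.refl _

/-- The sequence obtained by the first step from the sum of the simple sequences of `(1, 0)` and
`(m, k + 1)`. -/
def mergedRight (m k : ℕ) : List (Fin 2) := List.replicate m 1 ++ (List.replicate k 0 ++ [1, 0])

/-- The defect sits at the last two positions of `1^m 0^(k+1)`, and the extra one is coloured
`true`. The colours change roles: the `false` points form the simple summand. -/
theorem step_mergedRight (m k : ℕ) (hm : 1 ≤ m) (hk : 1 ≤ k) (hco : Nat.Coprime m (k + 1)) :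
    ∃ m' n' : ℕ, m' ≤ m ∧ n' ≤ k + 1 ∧ m * n' = (k + 1) * m' + 1 ∧
      Step ((simple (m - m', k + 1 - n')).sum (ofList (mergedRight m' (n' - 1))))
        (ofList (mergedRight m k)) := by
  obtain ⟨j, rfl⟩ := Nat.exists_eq_add_of_le' hk
  obtain ⟨c, fm, fn, hfm, hfn, hF, hc0, hc1, hrot, hm, hz, hz'⟩ :=
    exists_coloring m (j + 1 + 1) (m + j) hm (by omega) hco (by omega) (by omega)
  have hsplit : ∀ c' : ℕ → Bool, colors c' m (j + 1 + 1)
      = colors c' m j ++ [c' (m + j), c' (m + j + 1)] := by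
    intro c'
    rw [colors_add, colors_add, List.append_assoc]
    rfl
  have hx0 : exchangeColors c (m + j) (m + j) = false := by simp [exchangeColors]
  have hx1 : exchangeColors c (m + j) (m + j + 1) = true := by simp [exchangeColors]
  have hx : ∀ i, i ≠ m + j → i ≠ m + j + 1 → exchangeColors c (m + j) i = c i := fun i h h' => by
    simp [exchangeColors, h, h']
  have hC1 : colors (exchangeColors c (m + j)) m j = colors c m j :=
    colors_congr fun i h _ => hx i (by omega) (by omega)
  have hC2 : colors (exchangeColors c (m + j)) 0 m = colors c 0 m :=
    colors_congr fun i h _ => hx i (by omega) (by omega)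
  rw [colors_add c, Nat.zero_add, hsplit, hsplit, hC1, hC2, hx0, hx1, hc0, hc1] at hrot
  have hcnt : fn = (colors c m j).count true + 1 := by
    rw [← hz, hsplit, List.count_append, hc0, hc1]
    simp
  have hle : (colors c m j).count true ≤ j := by
    simpa [length_colors] using List.count_le_length (a := true) (l := colors c m j)
  refine ⟨fm, fn, hfm, hfn, hF, ?_⟩
  let L : List (Fin 2 × Bool) := colorSeg c 1 0 m ++ (colorSeg c 0 m j ++
    [(1, true), (0, false), (0, true)])
  have hiso := ofList_iso_sum_of_color L (by
    simp only [L, List.filter_append, List.filter_cons, colorSeg_filter_fst, List.map_append,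
      colorSeg_map_snd, List.map_cons, List.filter_nil]
    simp only [decide_true, decide_false, zero_ne_one, one_ne_zero, if_true, if_false,
      List.nil_append, List.map_cons,
      colorSeg_map_snd, List.map_nil, Bool.false_eq_true]
    have h2 := congrArg (· ++ [true]) hrot
    simpa only [List.append_assoc, List.cons_append, List.nil_append] using h2)
  simp only [L, List.filter_append, List.filter_cons, List.map_append, List.filter_nil,
    colorSeg_filter_snd, colorSeg_filter_not_snd, colorSeg_map_fst,
    List.map_cons, Bool.not_false, Bool.not_true, if_true, if_false, Bool.false_eq_true,
    List.map_nil, hm] at hiso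
  have hstep := step_exchange (List.replicate m 1 ++ List.replicate j 0) [0]
  simp only [List.append_assoc] at hstep
  refine (hstep.of_iso (hiso.trans (sum_comm _ _)).symm (Iso.refl _)).of_iso ?_ ?_
  · rw [show j - (colors c m j).count true = j + 1 - fn by omega,
      show (colors c m j).count true = fn - 1 by omega, ← List.replicate_succ',
      show j + 1 - fn + 1 = j + 1 + 1 - fn by omega]
    exact Iso.refl _
  · simp only [mergedRight, List.replicate_succ', List.append_assoc, List.cons_append,
      List.nil_append]
    exact Iso.refl _

/-- The sequence obtained by the first step from the sum of the simple sequences of `(m + 1, n)` and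
`(0, 1)`. -/
def mergedLeft (m n : ℕ) : List (Fin 2) := 1 :: 0 :: (List.replicate m 1 ++ List.replicate n 0)

/-- The defect sits at the first two positions of `1^(m+1) 0^n`, and the extra zero is coloured
`false`. -/
theorem step_mergedLeft (m n : ℕ) (hm : 1 ≤ m) (hn : 1 ≤ n) (hco : Nat.Coprime (m + 1) n) :
    ∃ fm fn : ℕ, fm ≤ m + 1 ∧ fn ≤ n ∧ (m + 1) * fn = n * fm + 1 ∧
      Step ((simple (fm, fn)).sum (ofList (mergedLeft (m - fm) (n - fn))))
        (ofList (mergedLeft m n)) := by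
  obtain ⟨e, rfl⟩ := Nat.exists_eq_add_of_le' hm
  obtain ⟨c, fm, fn, hfm, hfn, hF, hc0, hc1, hrot, hm, hz, hz'⟩ :=
    exists_coloring (e + 1 + 1) n 0 (by omega) hn hco (by omega) (by omega)
  have hsplit : ∀ c' : ℕ → Bool, colors c' 0 (e + 1 + 1)
      = c' 0 :: c' 1 :: colors c' 2 e := by
    intro c'
    rw [show e + 1 + 1 = 2 + e by omega, colors_add, Nat.zero_add]
    rfl
  have hx0 : exchangeColors c 0 0 = false := by simp [exchangeColors]
  have hx1 : exchangeColors c 0 1 = true := by simp [exchangeColors]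
  have hx : ∀ i, i ≠ 0 → i ≠ 1 → exchangeColors c 0 i = c i := fun i h h' => by
    simp [exchangeColors, h, h']
  have hC1 : colors (exchangeColors c 0) (e + 1 + 1) n = colors c (e + 1 + 1) n :=
    colors_congr fun i h _ => hx i (by omega) (by omega)
  have hC2 : colors (exchangeColors c 0) 2 e = colors c 2 e :=
    colors_congr fun i h _ => hx i (by omega) (by omega)
  have hc1' : c 1 = false := hc1
  rw [colors_add c, Nat.zero_add, hsplit, hsplit, hC1, hC2, hx0, hx1, hc0, hc1'] at hrot
  have hcnt : fm = (colors c 2 e).count true + 1 := by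
    rw [← hm, hsplit, hc0, hc1']
    simp
  have hle : (colors c 2 e).count true ≤ e := by
    simpa [length_colors] using List.count_le_length (a := true) (l := colors c 2 e)
  refine ⟨fm, fn, hfm, hfn, hF, ?_⟩
  let L : List (Fin 2 × Bool) := (1, false) :: (1, true) :: (0, false) ::
    (colorSeg c 1 2 e ++ colorSeg c 0 (e + 1 + 1) n)
  have hiso := ofList_iso_sum_of_color L (by
    simp only [L, List.filter_append, List.filter_cons, colorSeg_filter_fst, List.map_append,
      colorSeg_map_snd, List.map_cons]
    simp only [decide_true, decide_false, zero_ne_one, one_ne_zero, if_true, if_false,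
      List.nil_append, List.append_nil, List.map_cons,
      colorSeg_map_snd, Bool.false_eq_true]
    have h2 := congrArg (false :: ·) hrot
    simpa only [List.append_assoc, List.cons_append, List.nil_append] using h2)
  simp only [L, List.filter_append, List.filter_cons, List.map_append,
    colorSeg_filter_snd, colorSeg_filter_not_snd, colorSeg_map_fst,
    List.map_cons, Bool.not_false, Bool.not_true, if_true, if_false, Bool.false_eq_true, hz] at hiso
  have hstep := step_exchange [1] (List.replicate e 1 ++ List.replicate n 0)
  refine (hstep.of_iso hiso.symm (Iso.refl _)).of_iso ?_ ?_
  · rw [← List.cons_append, ← List.replicate_succ, ← hcnt,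
      show e - (colors c 2 e).count true = e + 1 - fm by omega]
    exact Iso.refl _
  · simp only [mergedLeft, List.replicate_succ, List.cons_append, List.nil_append]
    exact Iso.refl _

/-- The direct sum is the interleaving `1^(a+1) 0^b 1^n 0^(a+1) 1^(e+1) 0^n`, the colours telling
the summands apart. Exchanging `0 1` at the border of `0^(a+1)` and `1^(e+1)` merges them. -/
theorem step_merged_simple (a b n e : ℕ) :
    Step (ofList (merged a b n e)) ((simple (n + 1 + e, n)).sum (simple (a + 1, a + 1 + b))) := by
  let L : List (Fin 2 × Bool) := List.replicate (a + 1) (1, false) ++ (List.replicate b (0, false) ++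
    (List.replicate n (1, true) ++ (List.replicate (a + 1) (0, false) ++
      (List.replicate (e + 1) (1, true) ++ List.replicate n (0, true)))))
  have hiso := ofList_iso_sum_of_color L (by
    simp only [L, List.filter_append, List.map_append, List.filter_replicate, List.map_replicate]
    simp only [decide_true, decide_false, zero_ne_one, one_ne_zero, if_true, if_false,
      List.nil_append, List.append_nil, List.map_replicate,
      List.map_nil, Bool.false_eq_true]
    simp only [List.append_assoc, replicate_append_replicate, List.replicate_append_replicate]
    rw [show b + (a + 1) = a + 1 + b by omega, show n + (e + 1) = e + 1 + n by omega])
  simp only [L, List.filter_append, List.map_append, List.filter_replicate, List.map_replicate,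
    Bool.not_false, Bool.not_true, if_true, if_false, Bool.false_eq_true,
    List.nil_append, List.append_nil] at hiso
  have hstep := step_exchange (List.replicate (a + 1) 1 ++ (List.replicate b 0 ++
    (List.replicate n 1 ++ List.replicate a 0))) (List.replicate e 1 ++ List.replicate n 0)
  have he : List.replicate (a + 1) (0 : Fin 2) ++ (List.replicate (e + 1) 1 ++ List.replicate n 0)
      = List.replicate a 0 ++ 0 :: 1 :: (List.replicate e 1 ++ List.replicate n 0) := by
    simp only [List.replicate_succ' (n := a), List.replicate_succ (n := e),
      List.append_assoc, List.cons_append, List.nil_append]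
  rw [he] at hiso
  simp only [List.append_assoc] at hstep
  refine (hstep.of_iso (Iso.refl _) hiso.symm).of_iso ?_ ?_
  · simp only [merged, List.append_assoc]
    exact Iso.refl _
  · simp only [simple, replicate_append_replicate]
    rw [show n + 1 + e = n + (e + 1) by omega, show a + 1 + b = b + (a + 1) by omega,
      ← List.replicate_append_replicate (n := b)]
    exact Iso.refl _

theorem step_mergedLeft_simple (m n : ℕ) :
    Step (ofList (mergedLeft m n)) ((simple (m + 1, n)).sum (simple (0, 1))) := by
  let L : List (Fin 2 × Bool) :=
    (0, false) :: (List.replicate (m + 1) (1, true) ++ List.replicate n (0, true))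
  have hiso := ofList_iso_sum_of_color L (by
    simp only [L, List.filter_append, List.filter_cons, List.map_append, List.filter_replicate,
      List.map_replicate, List.map_cons]
    simp only [decide_true, decide_false, zero_ne_one, one_ne_zero, if_true, if_false,
      List.nil_append, List.append_nil, List.map_replicate, List.map_cons,
      Bool.false_eq_true, List.cons_append, List.replicate_append_replicate]
    rw [show n + (m + 1) = m + 1 + n by omega])
  simp only [L, List.filter_append, List.filter_cons, List.map_append, List.filter_replicate,
    List.map_replicate, List.map_cons, Bool.not_false, Bool.not_true, if_true, if_false,
    Bool.false_eq_true, List.map_nil, List.append_nil] at hiso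
  have hstep := step_exchange [] (List.replicate m 1 ++ List.replicate n 0)
  exact (hstep.of_iso (Iso.refl _) hiso.symm)

end LabelledMap

/-! ### Lattice paths below a corner -/

/-- The determinant of two pairs. -/
def cross (s t : ℕ × ℕ) : ℤ := s.1 * t.2 - s.2 * t.1

theorem cross_add_left (s s' t : ℕ × ℕ) : cross (s + s') t = cross s t + cross s' t := by
  simp only [cross, Prod.fst_add, Prod.snd_add]
  push_cast
  ring

theorem cross_add_right (s t t' : ℕ × ℕ) : cross s (t + t') = cross s t + cross s t' := by
  simp only [cross, Prod.fst_add, Prod.snd_add]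
  push_cast
  ring

theorem cross_zero_right (s : ℕ × ℕ) : cross s 0 = 0 := by simp [cross]

theorem cross_same (s : ℕ × ℕ) : cross s s = 0 := by
  simp only [cross]
  ring

theorem cross_comm (s t : ℕ × ℕ) : cross s t = -cross t s := by
  simp only [cross]
  ring

theorem coprime_of_cross_eq_one {s t : ℕ × ℕ} (h : cross s t = 1) :
    Nat.Coprime s.1 s.2 ∧ Nat.Coprime t.1 t.2 := by
  simp only [cross] at h
  constructor
  · rw [← Nat.isCoprime_iff_coprime]
    exact ⟨t.2, -t.1, by linear_combination h⟩
  · rw [← Nat.isCoprime_iff_coprime]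
    exact ⟨-s.2, s.1, by linear_combination h⟩

theorem cross_sum_nonneg {s : ℕ × ℕ} {l : List (ℕ × ℕ)} (h : ∀ t ∈ l, 0 ≤ cross s t) :
    0 ≤ cross s l.sum := by
  induction l with
  | nil => simp [cross_zero_right]
  | cons t l ih =>
    rw [List.sum_cons, cross_add_right]
    exact add_nonneg (h t (by simp)) (ih fun u hu => h u (by simp [hu]))

theorem sum_cross_nonneg {s : ℕ × ℕ} {l : List (ℕ × ℕ)} (h : ∀ t ∈ l, 0 ≤ cross t s) :
    0 ≤ cross l.sum s := by
  induction l with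
  | nil => simp [cross]
  | cons t l ih =>
    rw [List.sum_cons, cross_add_left]
    exact add_nonneg (h t (by simp)) (ih fun u hu => h u (by simp [hu]))

/-- `fs`, read from its end, is the lower boundary of the convex hull of the lattice points above
the path `e₁, e₂`, apart from the corner `e₁` itself. -/
structure IsHull (e₁ e₂ : ℕ × ℕ) (fs : List (ℕ × ℕ)) : Prop where
  coprime : ∀ f ∈ fs, Nat.Coprime f.1 f.2
  sorted : fs.Pairwise fun s t => 0 ≤ cross t s
  sum : fs.sum = e₁ + e₂
  dist : ∀ pre f l, fs = pre ++ f :: l → cross f l.sum - cross f e₁ = 1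
  left : ∀ f ∈ fs, 0 < cross e₁ f
  right : ∀ f ∈ fs, 0 < cross f e₂

/-! ### Extending a hull by one segment at either end -/

namespace IsHull

theorem singleton : IsHull (1, 0) (0, 1) [(1, 1)] where
  coprime := by simp
  sorted := by simp
  sum := by simp
  dist := by
    intro pre f l h
    rcases pre with _ | ⟨x, pre⟩
    · simp only [List.nil_append, List.cons.injEq] at h
      obtain ⟨rfl, rfl⟩ := h
      simp [cross]
    · simp at h
  left := by simp [cross]
  right := by simp [cross]

/-- Lists are read from the end, so `f` becomes the initial segment. The main point is convexity,
first against the old initial segment `g₀`, which like `f` has determinant one with `e₁`; the other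
segments follow through `g₀`. -/
theorem append {e₁ e₂ f : ℕ × ℕ} {fs : List (ℕ × ℕ)} (h : IsHull e₁ e₂ fs)
    (hf : cross e₁ f = 1) (hf₂ : 0 < cross f e₂) : IsHull (e₁ + f) e₂ (fs ++ [f]) := by
  have hs : ∀ g ∈ fs, 0 ≤ cross f g := by
    rcases List.eq_nil_or_concat fs with rfl | ⟨pre, g₀, rfl⟩
    · simp
    rw [List.concat_eq_append] at h ⊢
    have h0 : cross e₁ g₀ = 1 := by
      have := h.dist pre g₀ [] rfl
      rw [List.sum_nil, cross_zero_right, cross_comm g₀ e₁] at this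
      linarith
    have hpre : 0 ≤ cross pre.sum e₂ :=
      sum_cross_nonneg fun t ht => (h.right t (by simp [ht])).le
    have hg : 0 < cross g₀ e₂ := h.right g₀ (by simp)
    have hsum : cross pre.sum e₂ + cross g₀ e₂ = cross e₁ e₂ := by
      have := congrArg (cross · e₂) h.sum
      simp only [List.sum_append, List.sum_singleton, cross_add_left, cross_same] at this
      linarith
    have hpl : cross g₀ e₂ * cross e₁ f + cross f g₀ * cross e₁ e₂ = cross f e₂ * cross e₁ g₀ := by
      simp only [cross]
      ring
    rw [hf, h0] at hpl
    -- By integrality a negative value is at most `-1`, and the Plücker relation `hpl` would give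
    -- `cross f e₂ ≤ cross g₀ e₂ - cross e₁ e₂ ≤ 0`.
    have hfg : 0 ≤ cross f g₀ := by
      by_contra hneg
      nlinarith
    intro g hg'
    rcases List.mem_append.1 hg' with hg' | hg'
    · have h1 : 0 ≤ cross g₀ g := (List.pairwise_append.1 h.sorted).2.2 g hg' g₀ (by simp)
      have h2 := h.left g (by simp [hg'])
      have hpl' : cross f g * cross e₁ g₀ = cross f g₀ * cross e₁ g + cross g₀ g * cross e₁ f := by
        simp only [cross]
        ring
      rw [h0, hf] at hpl'
      nlinarith [mul_nonneg hfg h2.le]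
    · rw [List.mem_singleton.1 hg']
      exact hfg
  constructor
  · intro g hg
    rcases List.mem_append.1 hg with hg | hg
    · exact h.coprime g hg
    · rw [List.mem_singleton.1 hg]
      exact (coprime_of_cross_eq_one hf).2
  · exact List.pairwise_append.2 ⟨h.sorted, by simp, fun g hg f' hf' => by
      rw [List.mem_singleton.1 hf']
      exact hs g hg⟩
  · rw [List.sum_append, List.sum_singleton, h.sum, add_right_comm]
  · intro pre g l hl
    rcases List.eq_nil_or_concat l with rfl | ⟨l, f', rfl⟩
    · obtain ⟨rfl, hg⟩ := List.append_inj' hl rfl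
      obtain rfl : f = g := by simpa using hg
      rw [List.sum_nil, cross_zero_right, cross_add_right, cross_same, cross_comm f e₁, hf]
      norm_num
    · rw [List.concat_eq_append, ← List.cons_append, ← List.append_assoc] at hl
      obtain ⟨hfs, hf'⟩ := List.append_inj' hl rfl
      obtain rfl : f = f' := by simpa using hf'
      have := h.dist pre g l hfs
      rw [List.concat_eq_append, List.sum_append, List.sum_singleton, cross_add_right,
        cross_add_right]
      linarith
  · intro g hg
    rw [cross_add_left]
    rcases List.mem_append.1 hg with hg | hg
    · exact add_pos_of_pos_of_nonneg (h.left g hg) (hs g hg)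
    · rw [List.mem_singleton.1 hg, hf, cross_same]
      norm_num
  · intro g hg
    rcases List.mem_append.1 hg with hg | hg
    · exact h.right g hg
    · rw [List.mem_singleton.1 hg]
      exact hf₂

/-- The mirror image of `append`, with `f` as the new final segment. -/
theorem cons {e₁ e₂ f : ℕ × ℕ} {fs : List (ℕ × ℕ)} (h : IsHull e₁ e₂ fs)
    (hf : cross f e₂ = 1) (hf₁ : 0 < cross e₁ f) : IsHull e₁ (e₂ + f) (f :: fs) := by
  have hs : ∀ g ∈ fs, 0 ≤ cross g f := by
    rcases fs with _ | ⟨g₀, l⟩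
    · simp
    have hsum : ∀ g, cross g g₀ + cross g l.sum = cross g e₁ + cross g e₂ := by
      intro g
      rw [← cross_add_right, ← cross_add_right, ← h.sum, List.sum_cons]
    have h0 : cross g₀ e₂ = 1 := by
      have := h.dist [] g₀ l rfl
      have := hsum g₀
      rw [cross_same] at this
      linarith
    have hl : 0 ≤ cross e₁ l.sum := cross_sum_nonneg fun t ht => (h.left t (by simp [ht])).le
    have hg : 0 < cross e₁ g₀ := h.left g₀ (by simp)
    have he := hsum e₁
    rw [cross_same] at he
    have hpl : cross g₀ f * cross e₁ e₂ + cross e₁ g₀ * cross f e₂ = cross e₁ f * cross g₀ e₂ := by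
      simp only [cross]
      ring
    rw [hf, h0] at hpl
    have hfg : 0 ≤ cross g₀ f := by
      by_contra hneg
      nlinarith
    intro g hg'
    rcases List.mem_cons.1 hg' with rfl | hg'
    · exact hfg
    · have h1 : 0 ≤ cross g g₀ := (List.pairwise_cons.1 h.sorted).1 g hg'
      have h2 := h.right g (by simp [hg'])
      have hpl' : cross g f * cross g₀ e₂ = cross g g₀ * cross f e₂ + cross g₀ f * cross g e₂ := by
        simp only [cross]
        ring
      rw [h0, hf] at hpl'
      nlinarith [mul_nonneg hfg h2.le]
  constructor
  · intro g hg
    rcases List.mem_cons.1 hg with rfl | hg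
    · exact (coprime_of_cross_eq_one hf).1
    · exact h.coprime g hg
  · exact List.pairwise_cons.2 ⟨hs, h.sorted⟩
  · rw [List.sum_cons, h.sum, add_comm, add_assoc]
  · intro pre g l hl
    rcases pre with _ | ⟨x, pre⟩
    · simp only [List.nil_append, List.cons.injEq] at hl
      obtain ⟨rfl, rfl⟩ := hl
      rw [h.sum, cross_add_right, hf]
      ring
    · simp only [List.cons_append, List.cons.injEq] at hl
      exact h.dist pre g l hl.2
  · intro g hg
    rcases List.mem_cons.1 hg with rfl | hg
    · exact hf₁
    · exact h.left g hg
  · intro g hg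
    rw [cross_add_right]
    rcases List.mem_cons.1 hg with rfl | hg
    · rw [hf, cross_same]
      norm_num
    · exact add_pos_of_pos_of_nonneg (h.right g hg) (hs g hg)

theorem map {e₁ e₂ : ℕ × ℕ} {fs : List (ℕ × ℕ)} (h : IsHull e₁ e₂ fs)
    (φ : ℕ × ℕ →+ ℕ × ℕ) (hφ : ∀ s t, cross (φ s) (φ t) = cross s t)
    (hc : ∀ s : ℕ × ℕ, Nat.Coprime s.1 s.2 → Nat.Coprime (φ s).1 (φ s).2) :
    IsHull (φ e₁) (φ e₂) (fs.map φ) where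
  coprime := by
    intro f hf
    obtain ⟨g, hg, rfl⟩ := List.mem_map.1 hf
    exact hc g (h.coprime g hg)
  sorted := List.pairwise_map.2 (h.sorted.imp fun {s t} hst => by rwa [hφ])
  sum := by rw [← map_list_sum, h.sum, map_add]
  dist := by
    intro pre f l hl
    obtain ⟨pre, l', rfl, rfl, hl'⟩ := List.map_eq_append_iff.1 hl
    obtain ⟨f, l, rfl, rfl, rfl⟩ := List.map_eq_cons_iff.1 hl'
    rw [← map_list_sum, hφ, hφ]
    exact h.dist pre f l rfl
  left := by
    intro f hf
    obtain ⟨g, hg, rfl⟩ := List.mem_map.1 hf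
    rw [hφ]
    exact h.left g hg
  right := by
    intro f hf
    obtain ⟨g, hg, rfl⟩ := List.mem_map.1 hf
    rw [hφ]
    exact h.right g hg

end IsHull

/-! ### Resolving one corner: splitting off hull segments and Euclidean descent -/

namespace LabelledMap

/-- There is a hull of the path `e₁, e₂` whose sum of simple sequences is connected to `X` by a
chain with one step less than the number of its segments. -/
def Fills (X : LabelledMap) (e₁ e₂ : ℕ × ℕ) : Prop :=
  ∃ fs n, IsHull e₁ e₂ fs ∧ fs.length = n + 1 ∧ Chain n (simpleSum fs) X

theorem Fills.of_iso {X Y : LabelledMap} {e₁ e₂ : ℕ × ℕ} (h : Fills X e₁ e₂) (hY : Iso Y X) :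
    Fills Y e₁ e₂ := by
  obtain ⟨fs, n, h1, h2, h3⟩ := h
  exact ⟨fs, n, h1, h2, h3.of_iso (Iso.refl _) hY⟩

theorem fills_singleton : Fills (ofList [1, 0]) (1, 0) (0, 1) :=
  ⟨[(1, 1)], 0, IsHull.singleton, rfl, .nil (sum_empty _)⟩

theorem Fills.append {X Y : LabelledMap} {e₁ e₂ f : ℕ × ℕ} (h : Fills X e₁ e₂)
    (hf : cross e₁ f = 1) (hf₂ : 0 < cross f e₂) (hY : Step ((simple f).sum X) Y) :
    Fills Y (e₁ + f) e₂ := by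
  obtain ⟨fs, n, h1, h2, h3⟩ := h
  refine ⟨fs ++ [f], n + 1, h1.append hf hf₂, by simp [h2], ?_⟩
  refine ((h3.add_left (isSeq_simple f)).of_iso ?_ (Iso.refl _)).snoc hY
  exact ((simpleSum_append _ [f]).trans ((Iso.refl _).sum (sum_empty (simple f)))).trans
    (sum_comm _ _)

theorem Fills.cons {X Y : LabelledMap} {e₁ e₂ f : ℕ × ℕ} (h : Fills X e₁ e₂)
    (hf : cross f e₂ = 1) (hf₁ : 0 < cross e₁ f) (hY : Step ((simple f).sum X) Y) :
    Fills Y e₁ (e₂ + f) := by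
  obtain ⟨fs, n, h1, h2, h3⟩ := h
  exact ⟨f :: fs, n + 1, h1.cons hf hf₁, by simp [h2], (h3.add_left (isSeq_simple f)).snoc hY⟩

/-- Each step splits `e₂` into its Farey parents: the flatter one is the last hull segment, and the
steeper one replaces `e₂`, until `e₂ = (0, 1)`. -/
theorem fills_mergedRight (m : ℕ) : ∀ k, m ≤ k ∨ m = 0 → Nat.Coprime m (k + 1) →
    Fills (ofList (mergedRight m k)) (1, 0) (m, k + 1) := by
  induction m using Nat.strong_induction_on with
  | _ m ih =>
    intro k hmk hco
    rcases Nat.eq_zero_or_pos m with rfl | hm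
    · obtain rfl : k = 0 := by simpa using hco
      exact fills_singleton
    have hmk : m ≤ k := by omega
    obtain ⟨m', n', hm', hn', hF, hstep⟩ := step_mergedRight m k hm (by omega) hco
    have hlt : m' < n' := by
      by_contra hle
      have : m * n' ≤ k * m' := Nat.mul_le_mul hmk (by omega)
      nlinarith
    have hne : m' ≠ m := by
      rintro rfl
      have h1 : k + 1 < n' := by
        by_contra hle
        have : m' * n' ≤ m' * (k + 1) := Nat.mul_le_mul le_rfl (by omega)
        nlinarith
      omega
    have hne' : n' ≠ k + 1 := by
      rintro rfl
      have : m' + 1 ≤ m := by omega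
      nlinarith
    obtain ⟨n, rfl⟩ : ∃ n, n' = n + 1 := ⟨n' - 1, by omega⟩
    obtain ⟨a, rfl⟩ := Nat.exists_eq_add_of_le hm'
    obtain ⟨b, hb⟩ := Nat.exists_eq_add_of_le hn'
    have hco' : Nat.Coprime m' (n + 1) := by
      rw [← Nat.isCoprime_iff_coprime]
      refine ⟨-(k + 1 : ℕ), (m' + a : ℕ), ?_⟩
      have := congrArg (Nat.cast (R := ℤ)) hF
      push_cast at this ⊢
      linarith
    have := (ih m' (by omega) n (Or.inl (by omega)) hco').cons (f := (a, b)) (Y := ofList (mergedRight (m' + a) k)) ?_ ?_ ?_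
    · rw [hb]
      exact this
    · have := congrArg (Nat.cast (R := ℤ)) hF
      have hb := congrArg (Nat.cast (R := ℤ)) hb
      simp only [cross]
      push_cast at this hb ⊢
      linear_combination this + m' * hb
    · simp only [cross]
      push_cast
      omega
    · rw [show m' + a - m' = a by omega, hb, show n + 1 + b - (n + 1) = b by omega,
        Nat.add_sub_cancel] at hstep
      exact hstep

/-- The segment that is split off from `(m, n)` in the presence of `fm / fn`. -/
theorem farey_left {m n fm fn : ℕ} (hnm : n < m) (hfm : fm ≤ m) (hfn : fn ≤ n)
    (h : m * fn = n * fm + 1) :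
    0 < fn ∧ fn ≤ fm ∧ n - fn < m - fm ∧ Nat.Coprime (m - fm) (n - fn) ∧
      cross (m - fm, n - fn) (fm, fn) = 1 := by
  have h0 : 0 < fn := by
    rcases Nat.eq_zero_or_pos fn with rfl | h0
    · omega
    · exact h0
  have h1 : fn ≤ fm := by
    by_contra hlt
    have : n * fm + n + fn ≤ m * fn := by nlinarith
    omega
  have hc : cross (m - fm, n - fn) (fm, fn) = 1 := by
    have := congrArg (Nat.cast (R := ℤ)) h
    simp only [cross]
    push_cast [Nat.cast_sub hfm, Nat.cast_sub hfn] at this ⊢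
    linarith
  refine ⟨h0, h1, ?_, (coprime_of_cross_eq_one hc).1, hc⟩
  by_contra hle
  simp only [cross] at hc
  have h2 : ((m - fm : ℕ) : ℤ) ≤ (n - fn : ℕ) := by exact_mod_cast not_lt.1 hle
  have h3 : (fn : ℤ) ≤ fm := by exact_mod_cast h1
  have := mul_le_mul h2 h3 (by positivity) (by positivity)
  linarith

/-- The steeper Farey parent of `e₁` is split off as the first hull segment until `e₁ = (1, 0)`;
then `fills_mergedRight` consumes `e₂`. -/
theorem fills_merged (a b : ℕ) (hco₂ : Nat.Coprime (a + 1) (a + 1 + (b + 1))) (n : ℕ) :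
    ∀ e, Nat.Coprime (n + 1 + e) n →
      Fills (ofList (merged a (b + 1) n e)) (n + 1 + e, n) (a + 1, a + 1 + (b + 1)) := by
  induction n using Nat.strong_induction_on with
  | _ n ih =>
    intro e hco
    rcases Nat.eq_zero_or_pos n with rfl | hn
    · obtain rfl : e = 0 := by simpa using hco
      have := fills_mergedRight (a + 1) (b + 1 + a) (Or.inl (by omega))
        (by rwa [show b + 1 + a + 1 = a + 1 + (b + 1) by omega])
      rw [show b + 1 + a + 1 = a + 1 + (b + 1) by omega] at this
      refine this.of_iso ?_
      simp only [merged, mergedRight, List.append_assoc, List.replicate_zero, List.nil_append]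
      rw [replicate_append_replicate]
      exact Iso.refl _
    obtain ⟨n, rfl⟩ : ∃ n', n = n' + 1 := ⟨n - 1, by omega⟩
    -- For `e = 0` the Farey parents of `e₁ = (n + 2, n + 1)` are `(n + 1, n)` and `(1, 1)`.
    rcases e with _ | e
    · refine (ih n (by omega) 0 (by simp)).append (f := (1, 1)) ?_ ?_ (step_merged_zero a b n)
      · simp [cross]
      · simp only [cross]
        push_cast
        omega
    · obtain ⟨fm, fn, hfm, hfn, hF, hstep⟩ := step_merged_of_two_le a (b + 1) (n + 1) e hn
        (by rwa [show n + 1 + 2 + e = n + 1 + 1 + (e + 1) by omega])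
      obtain ⟨h1, h2, h3, h4, h5⟩ := farey_left (by omega) hfm hfn hF
      have hm : n + 1 - fn + 1 + (e + 1 + fn - fm) = n + 1 + 2 + e - fm := by omega
      have := (ih (n + 1 - fn) (by omega) (e + 1 + fn - fm) (by rwa [hm])).append
        (f := (fm, fn)) (by rwa [hm]) ?_ hstep
      · rw [hm] at this
        convert this using 1
        simp only [Prod.mk_add_mk, Prod.mk.injEq]
        omega
      · simp only [cross]
        push_cast
        have : (fn : ℤ) ≤ fm := by exact_mod_cast h2
        have : (0 : ℤ) < fn := by exact_mod_cast h1
        nlinarith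

theorem fills_mergedLeft (n : ℕ) : ∀ m, n ≤ m → Nat.Coprime (m + 1) n →
    Fills (ofList (mergedLeft m n)) (m + 1, n) (0, 1) := by
  induction n using Nat.strong_induction_on with
  | _ n ih =>
    intro m hnm hco
    rcases Nat.eq_zero_or_pos n with rfl | hn
    · obtain rfl : m = 0 := by simpa using hco
      exact fills_singleton
    obtain ⟨fm, fn, hfm, hfn, hF, hstep⟩ := step_mergedLeft m n (by omega) hn hco
    obtain ⟨h1, h2, h3, h4, h5⟩ := farey_left (by omega) hfm hfn hF
    have hm : m - fm + 1 = m + 1 - fm := by omega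
    have := (ih (n - fn) (by omega) (m - fm) (by omega) (by rwa [hm])).append
      (f := (fm, fn)) (by rwa [hm]) ?_ hstep
    · rw [hm] at this
      convert this using 1
      simp only [Prod.mk_add_mk, Prod.mk.injEq]
      omega
    · simp only [cross]
      push_cast
      omega

theorem Fills.hull {X : LabelledMap} {e₁ e₂ : ℕ × ℕ} (h : Fills X e₁ e₂)
    (hX : Step X ((simple e₁).sum (simple e₂))) :
    ∃ fs, IsHull e₁ e₂ fs ∧ Chain fs.length (simpleSum fs) ((simple e₁).sum (simple e₂)) := by
  obtain ⟨fs, n, h1, h2, h3⟩ := h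
  exact ⟨fs, h1, h2 ▸ h3.snoc hX⟩

theorem exists_isHull_of_lt {e₁ e₂ : ℕ × ℕ} (h₁ : Nat.Coprime e₁.1 e₁.2)
    (h₂ : Nat.Coprime e₂.1 e₂.2) (hlt₁ : e₁.2 < e₁.1) (hlt₂ : e₂.1 < e₂.2) :
    ∃ fs, IsHull e₁ e₂ fs ∧ Chain fs.length (simpleSum fs) ((simple e₁).sum (simple e₂)) := by
  obtain ⟨m₁, n⟩ := e₁
  obtain ⟨m₂, n₂⟩ := e₂
  obtain ⟨e, rfl⟩ : ∃ e, m₁ = n + 1 + e := Nat.exists_eq_add_of_le hlt₁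
  rcases m₂ with _ | a
  · obtain rfl : n₂ = 1 := by simpa using h₂
    rw [show n + 1 + e = n + e + 1 by omega] at h₁ ⊢
    exact (fills_mergedLeft n (n + e) (by omega) h₁).hull (step_mergedLeft_simple _ _)
  · obtain ⟨b, rfl⟩ : ∃ b, n₂ = a + 1 + (b + 1) := ⟨n₂ - (a + 2), by simp at hlt₂; omega⟩
    exact (fills_merged a b h₂ n e h₁).hull (step_merged_simple _ _ _ _)

/-- Replacing a corner of a Newton polygon by the hull of the lattice points above it. -/
theorem exists_isHull (N : ℕ) : ∀ e₁ e₂ : ℕ × ℕ, e₁.1 + e₁.2 + e₂.1 + e₂.2 ≤ N →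
    Nat.Coprime e₁.1 e₁.2 → Nat.Coprime e₂.1 e₂.2 → 0 < cross e₁ e₂ →
    ∃ fs, IsHull e₁ e₂ fs ∧ Chain fs.length (simpleSum fs) ((simple e₁).sum (simple e₂)) := by
  induction N with
  | zero =>
    intro e₁ e₂ hN _ _ hpos
    simp only [cross] at hpos
    have h1 : e₁.1 = 0 := by omega
    have h2 : e₁.2 = 0 := by omega
    simp [h1, h2] at hpos
  | succ N ih =>
    intro e₁ e₂ hN h₁ h₂ hpos
    have hlt : e₁.2 * e₂.1 < e₁.1 * e₂.2 := by
      simp only [cross] at hpos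
      zify
      linarith
    have hm : 0 < e₁.1 := by
      by_contra h0
      simp [show e₁.1 = 0 by omega] at hlt
    have hn : 0 < e₂.2 := by
      by_contra h0
      simp [show e₂.2 = 0 by omega] at hlt
    -- Slopes strictly on different sides of 1/2 form the base case. Otherwise the same coordinate
    -- can be subtracted in both pairs; this lowers the total size and is undone by a substitution.
    rcases Nat.lt_or_ge e₁.2 e₁.1 with hlt₁ | hle₁
    · rcases Nat.lt_or_ge e₂.1 e₂.2 with hlt₂ | hle₂
      · exact exists_isHull_of_lt h₁ h₂ hlt₁ hlt₂
      obtain ⟨m₁, n₁⟩ := e₁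
      obtain ⟨m₂, n₂⟩ := e₂
      simp only at hlt₁ hle₂ hN hn
      obtain ⟨m₁, rfl⟩ := Nat.exists_eq_add_of_le' hlt₁.le
      obtain ⟨m₂, rfl⟩ := Nat.exists_eq_add_of_le' hle₂
      obtain ⟨fs, hfs, hch⟩ := ih (m₁, n₁) (m₂, n₂) (by simp only; omega) (by simpa using h₁)
        (by simpa using h₂) (by simp only [cross] at hpos ⊢; push_cast at hpos; linarith)
      let φ : ℕ × ℕ →+ ℕ × ℕ :=
        { toFun := fun s => (s.1 + s.2, s.2)
          map_zero' := rfl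
          map_add' := fun s t => by
            simp only [Prod.fst_add, Prod.snd_add, Prod.mk_add_mk, Prod.mk.injEq, and_true]
            omega }
      refine ⟨fs.map φ, hfs.map φ (fun s t => ?_) (fun s hs => ?_), ?_⟩
      · simp only [φ, AddMonoidHom.coe_mk, ZeroHom.coe_mk, cross]
        push_cast
        ring
      · simpa [φ] using hs
      · rw [List.length_map]
        exact hch.insertAfter_zero.of_iso (simpleSum_insertAfter_zero fs).symm
          (((insertAfter_sum 0 1 _ _).trans
            ((simple_insertAfter_zero _ _).sum (simple_insertAfter_zero _ _))).symm)
    · have hle₂ : e₂.1 ≤ e₂.2 := by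
        by_contra hlt₂
        have := Nat.mul_le_mul hle₁ (not_le.1 hlt₂).le
        nlinarith
      obtain ⟨m₁, n₁⟩ := e₁
      obtain ⟨m₂, n₂⟩ := e₂
      simp only at hle₁ hle₂ hN hm
      obtain ⟨n₁, rfl⟩ := Nat.exists_eq_add_of_le hle₁
      obtain ⟨n₂, rfl⟩ := Nat.exists_eq_add_of_le hle₂
      obtain ⟨fs, hfs, hch⟩ := ih (m₁, n₁) (m₂, n₂) (by simp only; omega) (by simpa using h₁)
        (by simpa using h₂) (by simp only [cross] at hpos ⊢; push_cast at hpos; linarith)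
      let φ : ℕ × ℕ →+ ℕ × ℕ :=
        { toFun := fun s => (s.1, s.1 + s.2)
          map_zero' := rfl
          map_add' := fun s t => by
            simp only [Prod.fst_add, Prod.snd_add, Prod.mk_add_mk, Prod.mk.injEq, true_and]
            omega }
      refine ⟨fs.map φ, hfs.map φ (fun s t => ?_) (fun s hs => ?_), ?_⟩
      · simp only [φ, AddMonoidHom.coe_mk, ZeroHom.coe_mk, cross]
        push_cast
        ring
      · simpa [φ] using hs
      · rw [List.length_map]
        exact hch.insertAfter_one.of_iso (simpleSum_insertAfter_one fs).symm
          (((insertAfter_sum 1 0 _ _).trans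
            ((simple_insertAfter_one _ _).sum (simple_insertAfter_one _ _))).symm)

end LabelledMap

/-! ### Newton polygons with a common end point -/

/-- Every segment of `ξ`, translated by `w`, lies on a line that passes below the point `q`. -/
def Below (w q : ℕ × ℕ) : List (ℕ × ℕ) → Prop
  | [] => True
  | s :: l => cross s (l.sum + w) ≤ cross s q ∧ Below w q l

theorem below_append {w q : ℕ × ℕ} {l l' : List (ℕ × ℕ)} :
    Below w q (l ++ l') ↔ Below (l'.sum + w) q l ∧ Below w q l' := by
  induction l with
  | nil => simp [Below]
  | cons s l ih => simp only [List.cons_append, Below, ih, List.sum_append, add_assoc, and_assoc]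

/-- Twice the sum of the values of the polygon at the integers `1, …, h`. -/
def twiceSum : List (ℕ × ℕ) → ℤ
  | [] => 0
  | s :: l => twiceSum l + 2 * (s.1 + s.2) * l.sum.2 + s.2 * (s.1 + s.2 + 1)

theorem twiceSum_append (l l' : List (ℕ × ℕ)) :
    twiceSum (l ++ l') = twiceSum l + twiceSum l' + 2 * (l.sum.1 + l.sum.2) * l'.sum.2 := by
  induction l with
  | nil => simp [twiceSum]
  | cons s l ih =>
    simp only [List.cons_append, twiceSum, ih, List.sum_append, List.sum_cons, Prod.fst_add,
      Prod.snd_add]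
    push_cast
    ring

/-- A crude bound depending only on the end point, which makes the raising of corners terminate. -/
theorem twiceSum_le (l : List (ℕ × ℕ)) :
    twiceSum l ≤ 2 * (l.sum.1 + l.sum.2) * l.sum.2 + l.sum.2 := by
  induction l with
  | nil => simp [twiceSum]
  | cons s l ih =>
    simp only [twiceSum, List.sum_cons, Prod.fst_add, Prod.snd_add]
    push_cast
    nlinarith [mul_nonneg (Int.natCast_nonneg l.sum.1) (Int.natCast_nonneg s.2),
      mul_nonneg (Int.natCast_nonneg l.sum.2) (Int.natCast_nonneg s.2),
      mul_nonneg (Int.natCast_nonneg s.1) (Int.natCast_nonneg s.2),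
      mul_nonneg (Int.natCast_nonneg s.2) (Int.natCast_nonneg s.2)]

/-- By `dist`, each hull segment spans with the corner `e₁` a triangle of doubled area one. The
closed form in `key` sums these along the hull. -/
theorem IsHull.twiceSum {e₁ e₂ : ℕ × ℕ} {fs : List (ℕ × ℕ)} (h : IsHull e₁ e₂ fs) :
    twiceSum fs = twiceSum [e₂, e₁] + fs.length := by
  have key : ∀ l : List (ℕ × ℕ), (∀ pre f l', l = pre ++ f :: l' → cross f l'.sum - cross f e₁ = 1) →
      _root_.twiceSum l = l.sum.2 + (l.sum.1 + l.sum.2) * l.sum.2 + l.length + cross l.sum e₁ := by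
    intro l hl
    induction l with
    | nil => simp [_root_.twiceSum, cross]
    | cons s l ih =>
      have h1 := hl [] s l rfl
      have h2 := ih fun pre f l' h' => hl (s :: pre) f l' (by rw [h', List.cons_append])
      simp only [_root_.twiceSum, h2, List.sum_cons, Prod.fst_add, Prod.snd_add, List.length_cons,
        cross] at h1 ⊢
      push_cast
      linear_combination h1
  rw [key fs h.dist, h.sum]
  simp only [_root_.twiceSum, cross, List.sum_cons, List.sum_nil, Prod.fst_add, Prod.snd_add,
    Prod.snd_zero]
  push_cast
  ring

/-- Each segment has lattice distance one from its parallel through the corner. A lattice point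
strictly above the parallel is thus on or above the segment's line. -/
theorem IsHull.below {e₁ e₂ w q : ℕ × ℕ} {fs : List (ℕ × ℕ)} (h : IsHull e₁ e₂ fs)
    (hq : ∀ f ∈ fs, cross f (e₁ + w) < cross f q) : Below w q fs := by
  have key : ∀ l : List (ℕ × ℕ), (∀ pre f l', l = pre ++ f :: l' → cross f l'.sum - cross f e₁ = 1) →
      (∀ f ∈ l, cross f (e₁ + w) < cross f q) → Below w q l := by
    intro l hl hq
    induction l with
    | nil => trivial
    | cons s l ih =>
      refine ⟨?_, ih (fun pre f l' h' => hl (s :: pre) f l' (by rw [h', List.cons_append]))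
        fun f hf => hq f (by simp [hf])⟩
      have h1 := hl [] s l rfl
      have h2 := hq s (by simp)
      rw [cross_add_right] at h2 ⊢
      linarith
  exact key fs h.dist hq

theorem eq_of_cross_eq_zero {s t : ℕ × ℕ} (hs : Nat.Coprime s.1 s.2) (ht : Nat.Coprime t.1 t.2)
    (h : cross s t = 0) : s = t := by
  have h' : s.1 * t.2 = s.2 * t.1 := by
    simp only [cross] at h
    zify
    linarith
  have h1 : s.1 = t.1 := Nat.dvd_antisymm (hs.dvd_of_dvd_mul_left ⟨t.2, h'.symm⟩)
    (ht.dvd_of_dvd_mul_right ⟨s.2, by rw [h']; ring⟩)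
  have h2 : s.2 = t.2 := Nat.dvd_antisymm (hs.symm.dvd_of_dvd_mul_left ⟨t.1, h'⟩)
    (ht.symm.dvd_of_dvd_mul_right ⟨s.1, by rw [← h']; ring⟩)
  exact Prod.ext h1 h2

theorem cross_nonneg_trans {z s t : ℕ × ℕ} (hzs : 0 ≤ cross z s) (hst : 0 < cross s t) :
    0 ≤ cross z t := by
  simp only [cross] at hzs hst ⊢
  -- The strict hypothesis forces `s.1 ≠ 0`, without which transitivity may fail.
  have hs : (0 : ℤ) < s.1 := by
    by_contra h0
    have : (s.1 : ℤ) = 0 := by omega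
    rw [this] at hst
    have := mul_nonneg (Int.natCast_nonneg s.2) (Int.natCast_nonneg t.1)
    linarith
  by_contra hneg
  have h1 := mul_nonneg hzs (Int.natCast_nonneg t.1)
  have h2 := mul_nonneg hst.le (Int.natCast_nonneg z.1)
  nlinarith

/-- `ζ` and `ξ` are Newton polygons with the same end point, and `ζ` lies above `ξ`. -/
structure LiesAbove (ζ ξ : List (ℕ × ℕ)) : Prop where
  coprime_left : ∀ s ∈ ζ, Nat.Coprime s.1 s.2
  coprime_right : ∀ s ∈ ξ, Nat.Coprime s.1 s.2
  sorted_left : ζ.Pairwise fun s t => 0 ≤ cross t s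
  sorted_right : ξ.Pairwise fun s t => 0 ≤ cross t s
  sum : ζ.sum = ξ.sum
  below : ∀ pre l, ζ = pre ++ l → Below 0 l.sum ξ

theorem ne_zero_of_coprime {s : ℕ × ℕ} (hs : Nat.Coprime s.1 s.2) : s ≠ 0 := by
  rintro rfl
  simp at hs

theorem eq_nil_of_sum_eq_zero {l : List (ℕ × ℕ)} (hl : ∀ s ∈ l, Nat.Coprime s.1 s.2)
    (h : l.sum = 0) : l = [] := by
  rcases l with _ | ⟨s, l⟩
  · rfl
  · rw [List.sum_cons, add_eq_zero] at h
    exact absurd h.1 (ne_zero_of_coprime (hl s (by simp)))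

theorem exists_corner (t : ℕ × ℕ) (l : List (ℕ × ℕ)) :
    (∀ x ∈ l, x = t) ∨ ∃ k e R, t :: l = List.replicate k t ++ ([t, e] ++ R) ∧ e ≠ t := by
  induction l with
  | nil => simp
  | cons x l ih =>
    by_cases hx : x = t
    · subst hx
      rcases ih with h | ⟨k, e, R, h, he⟩
      · exact Or.inl (by simpa using h)
      · exact Or.inr ⟨k + 1, e, R, by rw [h, List.replicate_succ]; rfl, he⟩
    · exact Or.inr ⟨0, x, l, rfl, hx⟩

/-! ### Comparing and raising polygons -/

namespace LiesAbove

theorem tail {s : ℕ × ℕ} {ζ ξ : List (ℕ × ℕ)} (h : LiesAbove (s :: ζ) (s :: ξ)) :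
    LiesAbove ζ ξ where
  coprime_left := fun s hs => h.coprime_left s (by simp [hs])
  coprime_right := fun s hs => h.coprime_right s (by simp [hs])
  sorted_left := (List.pairwise_cons.1 h.sorted_left).2
  sorted_right := (List.pairwise_cons.1 h.sorted_right).2
  sum := by simpa using h.sum
  below := fun pre l hl => (h.below (s :: pre) l (by rw [hl, List.cons_append])).2

/-- The upper polygon begins its final segment on or above the final line of the lower one and ends
at the same point, so it arrives no more steeply; coprimality excludes equal slopes. -/
theorem cross_head_pos {s t : ℕ × ℕ} {ζ ξ : List (ℕ × ℕ)} (h : LiesAbove (s :: ζ) (t :: ξ))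
    (hst : s ≠ t) : 0 < cross s t := by
  have h1 := (h.below [s] ζ rfl).1
  have h2 := congrArg (cross t) h.sum
  simp only [List.sum_cons, cross_add_right, cross_same, cross_zero_right] at h1 h2
  have h3 := cross_comm s t
  refine lt_of_le_of_ne (by linarith) fun h0 => hst ?_
  exact eq_of_cross_eq_zero (h.coprime_left s (by simp)) (h.coprime_right t (by simp)) h0.symm

/-- Raising the lower polygon at a corner that is not on the upper polygon. -/
theorem raise {s t e : ℕ × ℕ} {k : ℕ} {ζ R fs : List (ℕ × ℕ)}
    (h : LiesAbove (s :: ζ) (List.replicate k t ++ ([t, e] ++ R))) (hst : 0 < cross s t)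
    (het : 0 < cross e t) (hfs : IsHull e t fs) :
    LiesAbove (s :: ζ) (List.replicate k t ++ (fs ++ R)) := by
  have hz : ∀ z ∈ ζ, 0 ≤ cross z t := fun z hz =>
    cross_nonneg_trans ((List.pairwise_cons.1 h.sorted_left).1 z hz) hst
  have hsum : fs.sum = ([t, e] : List (ℕ × ℕ)).sum := by
    rw [hfs.sum]
    simp [add_comm]
  obtain ⟨hs1, hs2, hs3⟩ := List.pairwise_append.1 h.sorted_right
  obtain ⟨hs4, hs5, hs6⟩ := List.pairwise_append.1 hs2
  refine ⟨h.coprime_left, ?_, h.sorted_left, ?_, ?_, ?_⟩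
  · intro x hx
    rcases List.mem_append.1 hx with hx | hx
    · exact h.coprime_right x (by simp [hx])
    rcases List.mem_append.1 hx with hx | hx
    · exact hfs.coprime x hx
    · exact h.coprime_right x (by simp [hx])
  · refine List.pairwise_append.2 ⟨hs1, List.pairwise_append.2 ⟨hfs.sorted, hs5, ?_⟩, ?_⟩
    · intro f hf y hy
      exact cross_nonneg_trans (hs6 e (by simp) y hy) (hfs.left f hf)
    · intro x hx f hf
      rw [List.eq_of_mem_replicate hx]
      rcases List.mem_append.1 hf with hf | hf
      · exact (hfs.right f hf).le
      · exact hs6 t (by simp) f hf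
  · rw [h.sum]
    simp only [List.sum_append, hsum]
  · intro pre l hl
    have hb := h.below pre l hl
    rw [below_append, below_append] at hb ⊢
    refine ⟨by simpa only [List.sum_append, hsum] using hb.1, hfs.below fun f hf => ?_, hb.2.2⟩
    rw [add_zero]
    obtain ⟨hbt, hbe, -⟩ := hb.2.1
    simp only [List.sum_cons, List.sum_nil, add_zero, zero_add] at hbt hbe
    -- No vertex of the upper polygon is the corner `e + R.sum`: the end point is strictly above the
    -- line of `e`, and earlier vertices are strictly above the line of `t`, because `s` is flatter
    -- than `t`.
    have hne : cross e (e + R.sum) < cross e l.sum ∨ cross t (e + R.sum) < cross t l.sum := by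
      have hE := h.sum
      rw [hl] at hE
      simp only [List.sum_append, List.sum_replicate, List.sum_cons, List.sum_nil, add_zero] at hE
      rcases pre with _ | ⟨s', pre⟩
      · left
        have := congrArg (cross e) hE
        have hk : 0 ≤ cross e (k • t) := by
          simp only [cross, Prod.smul_fst, Prod.smul_snd, smul_eq_mul] at het ⊢
          push_cast
          nlinarith [mul_nonneg (Int.natCast_nonneg k) het.le]
        simp only [List.sum_nil, zero_add, cross_add_right, cross_same] at this ⊢
        linarith
      · right
        simp only [List.cons_append, List.cons.injEq] at hl
        obtain ⟨rfl, rfl⟩ := hl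
        have := congrArg (cross t) hE
        have hk : cross t (k • t) = 0 := by
          simp only [cross, Prod.smul_fst, Prod.smul_snd, smul_eq_mul]
          push_cast
          ring
        have hpre : 0 ≤ cross pre.sum t := sum_cross_nonneg fun z hz' => hz z (by simp [hz'])
        simp only [List.sum_cons, cross_add_right, cross_same, hk] at this ⊢
        rw [cross_comm t s, cross_comm t pre.sum] at this
        linarith
    -- Up to the factor `cross e t`, `f` is a positive combination of `e` and `t`, so one strict
    -- inequality for `e` or `t` gives a strict one for `f`.
    have hpl : ∀ x, cross f x * cross e t = cross f t * cross e x + cross e f * cross t x := by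
      intro x
      simp only [cross]
      ring
    have h1 := hpl l.sum
    have h2 := hpl (e + R.sum)
    have hbe' : cross e (e + R.sum) ≤ cross e l.sum := by
      rw [cross_add_right, cross_same]
      linarith
    have hft := hfs.right f hf
    have hef := hfs.left f hf
    have h3 : cross f (e + R.sum) * cross e t < cross f l.sum * cross e t := by
      rw [h1, h2]
      rcases hne with hne | hne
      · exact add_lt_add_of_lt_of_le (mul_lt_mul_of_pos_left hne hft)
          (mul_le_mul_of_nonneg_left hbt hef.le)
      · exact add_lt_add_of_le_of_lt (mul_le_mul_of_nonneg_left hbe' hft.le)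
          (mul_lt_mul_of_pos_left hne hef)
    exact lt_of_mul_lt_mul_right h3 het.le

end LiesAbove

/-! ### The chain between two Newton polygons -/

namespace LabelledMap

theorem sum_right_comm (X Y Z : LabelledMap) : Iso (X.sum (Y.sum Z)) ((X.sum Z).sum Y) :=
  ((Iso.refl X).sum (sum_comm Y Z)).trans (sum_assoc X Z Y).symm

theorem chain_replace {n : ℕ} {l l' : List (ℕ × ℕ)} (P R : List (ℕ × ℕ))
    (h : Chain n (simpleSum l) (simpleSum l')) :
    Chain n (simpleSum (P ++ (l ++ R))) (simpleSum (P ++ (l' ++ R))) := by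
  have hiso : ∀ l, Iso (simpleSum (P ++ (l ++ R))) (((simpleSum P).sum (simpleSum R)).sum
      (simpleSum l)) := fun l =>
    ((simpleSum_append _ _).trans ((Iso.refl _).sum (simpleSum_append _ _))).trans
      (sum_right_comm _ _ _)
  exact (h.add_left ((isSeq_simpleSum P).sum (isSeq_simpleSum R))).of_iso (hiso l) (hiso l')

/-- Common final segments are removed by induction on `ζ`. If the final segments differ, the last
corner of `ξ` is off `ζ` and is raised; `twiceSum` grows by the number of steps spent. The clause
for `r = 0` serves the case where both ends of the chain are the same module. -/
theorem exists_chain_of_liesAbove (ζ : List (ℕ × ℕ)) : ∀ ξ : List (ℕ × ℕ), LiesAbove ζ ξ →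
    ∃ r : ℕ, twiceSum ζ = twiceSum ξ + r ∧ Chain r (simpleSum ζ) (simpleSum ξ) ∧
      (r = 0 → ζ = ξ) := by
  induction ζ with
  | nil =>
    intro ξ h
    obtain rfl := eq_nil_of_sum_eq_zero h.coprime_right h.sum.symm
    exact ⟨0, by simp, .nil (Iso.refl _), fun _ => rfl⟩
  | cons s ζ ihζ =>
    -- `N` bounds the room left between `twiceSum ξ` and the bound of `twiceSum_le`.
    have key : ∀ N : ℕ, ∀ ξ : List (ℕ × ℕ), LiesAbove (s :: ζ) ξ →
        2 * (ξ.sum.1 + ξ.sum.2) * ξ.sum.2 + ξ.sum.2 ≤ twiceSum ξ + N →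
        ∃ r : ℕ, twiceSum (s :: ζ) = twiceSum ξ + r ∧
          Chain r (simpleSum (s :: ζ)) (simpleSum ξ) ∧ (r = 0 → s :: ζ = ξ) := by
      intro N
      induction N using Nat.strong_induction_on with
      | _ N ihN =>
        intro ξ h hN
        rcases ξ with _ | ⟨t, ξ⟩
        · exact absurd (eq_nil_of_sum_eq_zero h.coprime_left h.sum) (List.cons_ne_nil _ _)
        by_cases hst : s = t
        · subst hst
          obtain ⟨r, h1, h2, h3⟩ := ihζ ξ h.tail
          refine ⟨r, ?_, h2.add_left (isSeq_simple s), fun h0 => by rw [h3 h0]⟩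
          simp only [twiceSum, h1, h.tail.sum]
          ring
        have hpos := h.cross_head_pos hst
        have hct := h.coprime_right t (by simp)
        rcases exists_corner t ξ with hall | ⟨k, e, R, hξ, het⟩
        -- If `ξ` were straight, the segments of `ζ` would be at most as steep as `t` and `s`
        -- strictly flatter, so the end points could not agree.
        · exfalso
          have h1 : 0 ≤ cross ζ.sum t := sum_cross_nonneg fun z hz =>
            cross_nonneg_trans ((List.pairwise_cons.1 h.sorted_left).1 z hz) hpos
          have h2 : 0 ≤ cross t ξ.sum := cross_sum_nonneg fun x hx => by
            rw [hall x hx, cross_same]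
          have h3 := congrArg (cross · t) h.sum
          simp only [List.sum_cons, cross_add_left, cross_same] at h3
          rw [cross_comm ξ.sum t] at h3
          linarith
        rw [hξ] at h hN ⊢
        have hce := h.coprime_right e (by simp)
        have hpos' : 0 < cross e t := by
          refine lt_of_le_of_ne ?_ fun h0 => het (eq_of_cross_eq_zero hce hct h0.symm)
          have h4 := (List.pairwise_append.1 (List.pairwise_append.1 h.sorted_right).2.1).1
          simpa using h4
        obtain ⟨fs, hfs, hch⟩ := exists_isHull _ e t le_rfl hce hct hpos'
        have hlen : fs.length ≠ 0 := by
          intro h0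
          have := hfs.sum
          rw [List.length_eq_zero_iff.1 h0, List.sum_nil] at this
          exact ne_zero_of_coprime hct (add_eq_zero.1 this.symm).2
        have hsum : fs.sum = ([t, e] : List (ℕ × ℕ)).sum := by
          rw [hfs.sum]
          simp [add_comm]
        have hS : twiceSum (List.replicate k t ++ (fs ++ R))
            = twiceSum (List.replicate k t ++ ([t, e] ++ R)) + fs.length := by
          simp only [twiceSum_append, hfs.twiceSum, List.sum_append, hsum]
          ring
        have habove := h.raise hpos hpos' hfs
        have hE : (List.replicate k t ++ (fs ++ R)).sum
            = (List.replicate k t ++ ([t, e] ++ R)).sum := by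
          simp only [List.sum_append, hsum]
        have hbound := twiceSum_le (List.replicate k t ++ (fs ++ R))
        rw [hE] at hbound
        obtain ⟨r, h1, h2, h3⟩ := ihN (N - fs.length) (by omega) _ habove (by rw [hE]; omega)
        refine ⟨r + fs.length, ?_, h2.trans (chain_replace _ _ (hch.of_iso (Iso.refl _) ?_)),
          fun h0 => by omega⟩
        · rw [h1, hS]
          push_cast
          ring
        · exact ((Iso.refl _).sum (sum_empty (simple e))).trans (sum_comm _ _)
    intro ξ h
    exact key (2 * (ξ.sum.1 + ξ.sum.2) * ξ.sum.2 + ξ.sum.2 - twiceSum ξ).toNat ξ h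
      (by have := twiceSum_le ξ; omega)

end LabelledMap

/-! ### The graph of a Newton polygon -/

namespace NewtonPolygon

theorem listHeight_eq (l : List (ℕ × ℕ)) : listHeight l = l.sum.1 + l.sum.2 := by
  induction l with
  | nil => rfl
  | cons s l ih =>
    simp only [listHeight, List.map_cons, List.sum_cons, Prod.fst_add, Prod.snd_add] at ih ⊢
    omega

theorem listDim_eq (l : List (ℕ × ℕ)) : listDim l = l.sum.2 := by
  induction l with
  | nil => rfl
  | cons s l ih =>
    simp only [listDim, List.map_cons, List.sum_cons, Prod.snd_add] at ih ⊢
    omega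

theorem listHeight_cons (s : ℕ × ℕ) (l : List (ℕ × ℕ)) :
    listHeight (s :: l) = s.1 + s.2 + listHeight l := by
  simp [listHeight]

theorem listDim_cons (s : ℕ × ℕ) (l : List (ℕ × ℕ)) : listDim (s :: l) = s.2 + listDim l := by
  simp [listDim]

theorem segmentSlope_mul (s : ℕ × ℕ) : segmentSlope s * (s.1 + s.2) = s.2 := by
  rcases eq_or_ne ((s.1 : ℝ) + s.2) 0 with h | h
  · have : (s.2 : ℝ) = 0 := by
      have h1 : (0 : ℝ) ≤ s.1 := Nat.cast_nonneg _
      have h2 : (0 : ℝ) ≤ s.2 := Nat.cast_nonneg _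
      linarith
    rw [h, mul_zero, this]
  · exact div_mul_cancel₀ _ h

theorem height_pos_of_coprime {s : ℕ × ℕ} (hs : Nat.Coprime s.1 s.2) : 0 < s.1 + s.2 := by
  by_contra h
  have h1 : s.1 = 0 := by omega
  have h2 : s.2 = 0 := by omega
  simp [h1, h2] at hs

theorem cross_nonneg_of_segmentSlope_le {s t : ℕ × ℕ} (hs : Nat.Coprime s.1 s.2)
    (ht : Nat.Coprime t.1 t.2) (h : segmentSlope t ≤ segmentSlope s) : 0 ≤ cross t s := by
  have hs' : (0 : ℝ) < s.1 + s.2 := by exact_mod_cast height_pos_of_coprime hs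
  have ht' : (0 : ℝ) < t.1 + t.2 := by exact_mod_cast height_pos_of_coprime ht
  rw [segmentSlope, segmentSlope, div_le_div_iff₀ ht' hs'] at h
  have : (t.2 : ℤ) * (s.1 + s.2) ≤ s.2 * (t.1 + t.2) := by exact_mod_cast h
  simp only [cross]
  linarith

theorem listGraph_listHeight (l : List (ℕ × ℕ)) : listGraph l (listHeight l) = listDim l := by
  induction l with
  | nil => simp [listGraph, listDim]
  | cons s l ih =>
    rw [listGraph, listHeight_cons, listDim_cons]
    split_ifs with h
    · have h0 : s.1 + s.2 = 0 := by
        have : s.1 + s.2 + listHeight l ≤ listHeight l := by exact_mod_cast h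
        omega
      rw [h0, Nat.zero_add, ih, show s.2 = 0 by omega, Nat.zero_add]
    · push_cast
      rw [add_sub_cancel_right, segmentSlope_mul, add_comm]

theorem listGraph_append (l l' : List (ℕ × ℕ)) {x : ℝ} (hx : x ≤ listHeight l') :
    listGraph (l ++ l') x = listGraph l' x := by
  induction l with
  | nil => rfl
  | cons s l ih =>
    rw [List.cons_append, listGraph, if_pos, ih]
    refine hx.trans ?_
    rw [Nat.cast_le, listHeight_eq, listHeight_eq, List.sum_append, Prod.fst_add, Prod.snd_add]
    omega

/-- `cross s w' - cross s w` measures the height of `w'` above the line through `w` along `s`.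
Passing from `t` to `s` costs the slope difference times the horizontal distance. -/
theorem cross_identity (s t w w' : ℕ × ℕ) :
    (cross s w' - cross s w) * (t.1 + t.2)
      = (cross t w' - cross t w) * (s.1 + s.2)
        - cross t s * (w'.1 + w'.2 - (w.1 + w.2)) := by
  simp only [cross]
  ring

theorem below_mono {w q q' : ℕ × ℕ} {l : List (ℕ × ℕ)} (h : Below w q l)
    (hq : ∀ t ∈ l, cross t q ≤ cross t q') : Below w q' l := by
  induction l with
  | nil => trivial
  | cons s l ih => exact ⟨h.1.trans (hq s (by simp)), ih h.2 fun t ht => hq t (by simp [ht])⟩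

theorem below_sum {l : List (ℕ × ℕ)} (h : l.Pairwise fun s t => 0 ≤ cross t s) :
    Below 0 l.sum l := by
  induction l with
  | nil => trivial
  | cons s l ih =>
    obtain ⟨h1, h2⟩ := List.pairwise_cons.1 h
    refine ⟨?_, below_mono (ih h2) fun t ht => ?_⟩
    · rw [List.sum_cons, cross_add_right, cross_add_right, cross_same, cross_zero_right]
      linarith
    · rw [List.sum_cons, cross_add_right]
      linarith [h1 t ht]

/-- The lines through the segments of a Newton polygon lie below its graph. -/
theorem below_of_listGraph_le {l : List (ℕ × ℕ)} (hc : ∀ s ∈ l, Nat.Coprime s.1 s.2)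
    (hs : l.Pairwise fun s t => 0 ≤ cross t s) {q : ℕ × ℕ} (hq : q.1 + q.2 ≤ listHeight l)
    (h : listGraph l (q.1 + q.2 : ℕ) ≤ q.2) : Below 0 q l := by
  induction l with
  | nil => trivial
  | cons s l ih =>
    obtain ⟨h1, h2⟩ := List.pairwise_cons.1 hs
    have hc' : ∀ t ∈ l, Nat.Coprime t.1 t.2 := fun t ht => hc t (by simp [ht])
    have hpos : ∀ t ∈ s :: l, (0 : ℤ) < t.1 + t.2 := fun t ht => by
      exact_mod_cast height_pos_of_coprime (hc t ht)
    rw [listGraph] at h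
    split_ifs at h with hle
    · have hle' : q.1 + q.2 ≤ listHeight l := by exact_mod_cast hle
      have hb := ih hc' h2 hle' h
      refine ⟨?_, hb⟩
      rw [add_zero]
      -- Here `q` is not to the right of the start of `s`. There the line of `s` runs below that of
      -- the preceding, flatter segment `t`, and `q` is above the latter by induction.
      rcases l with _ | ⟨t, l⟩
      · have hq0 : q = 0 := by
          simp only [listHeight, List.map_nil, List.sum_nil] at hle'
          exact Prod.ext (by simp only [Prod.fst_zero]; omega) (by simp only [Prod.snd_zero]; omega)
        rw [hq0, List.sum_nil]
      · have hid := cross_identity s t (t :: l).sum q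
        have hb1 := hb.1
        rw [add_zero] at hb1
        have ht : cross t (t :: l).sum = cross t l.sum := by
          rw [List.sum_cons, cross_add_right, cross_same, zero_add]
        rw [listHeight_eq] at hle'
        have hle'' : (q.1 : ℤ) + q.2 ≤ (t :: l).sum.1 + (t :: l).sum.2 := by exact_mod_cast hle'
        have hnn : 0 ≤ (cross s q - cross s (t :: l).sum) * ((t.1 : ℤ) + t.2) := by
          rw [hid, ht]
          have := mul_nonneg (sub_nonneg.2 hb1) (hpos s (by simp)).le
          have := mul_nonneg (h1 t (by simp)) (sub_nonneg.2 hle'')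
          linarith
        have := nonneg_of_mul_nonneg_left hnn (hpos t (by simp))
        linarith
    · have hle' : listHeight l < q.1 + q.2 := by
        rw [← not_le]
        exact fun h' => hle (by exact_mod_cast h')
      have hline : cross s l.sum ≤ cross s q := by
        have hs0 : (0 : ℝ) ≤ s.1 + s.2 := by positivity
        have h3 := mul_le_mul_of_nonneg_right h hs0
        rw [add_mul, mul_right_comm, segmentSlope_mul, listHeight_eq, listDim_eq] at h3
        have h4 : (l.sum.2 : ℤ) * (s.1 + s.2) + s.2 * ((q.1 + q.2 : ℕ) - (l.sum.1 + l.sum.2 : ℕ))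
            ≤ q.2 * (s.1 + s.2) := by exact_mod_cast h3
        simp only [cross]
        push_cast at h4
        linarith
      -- To the right of `l.sum`, the lines of the flatter segments stay below the line of `s`.
      refine ⟨by rwa [add_zero], below_mono (below_sum h2) fun t ht => ?_⟩
      have hid := cross_identity t s l.sum q
      rw [listHeight_eq] at hle'
      have hle'' : (l.sum.1 : ℤ) + l.sum.2 ≤ q.1 + q.2 := by exact_mod_cast hle'.le
      have hnn : 0 ≤ (cross t q - cross t l.sum) * ((s.1 : ℤ) + s.2) := by
        rw [hid, cross_comm s t]
        have := mul_nonneg (sub_nonneg.2 hline) (hpos t (by simp [ht])).le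
        have := mul_nonneg (h1 t ht) (sub_nonneg.2 hle'')
        linarith
      have := nonneg_of_mul_nonneg_left hnn (hpos s (by simp))
      linarith

theorem pairwise_cross (ξ : NewtonPolygon) : ξ.segs.Pairwise fun s t => 0 ≤ cross t s :=
  ξ.sorted.imp_of_mem fun hs ht h =>
    cross_nonneg_of_segmentSlope_le (ξ.coprime _ hs) (ξ.coprime _ ht) h

theorem Prec.liesAbove {ζ ξ : NewtonPolygon} (h : ζ.Prec ξ) : LiesAbove ζ.segs ξ.segs where
  coprime_left := ζ.coprime
  coprime_right := ξ.coprime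
  sorted_left := ζ.pairwise_cross
  sorted_right := ξ.pairwise_cross
  sum := by
    have h1 := h.1
    have h2 := h.2.1
    rw [height, height, listHeight_eq, listHeight_eq] at h1
    rw [dim, dim, listDim_eq, listDim_eq] at h2
    exact Prod.ext (by omega) h2
  below := by
    intro pre l hl
    have hle : listHeight l ≤ ξ.height := by
      rw [← h.1, height, hl, listHeight_eq, listHeight_eq, List.sum_append, Prod.fst_add,
        Prod.snd_add]
      omega
    have hgraph := h.2.2 (listHeight l : ℕ) ⟨by positivity, by exact_mod_cast hle⟩
    rw [graph, graph, hl, listGraph_append _ _ le_rfl, listGraph_listHeight, listDim_eq,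
      listHeight_eq] at hgraph
    exact below_of_listGraph_le ξ.coprime ξ.pairwise_cross (by rwa [listHeight_eq] at hle) hgraph

theorem sum_Icc_one {M : Type} [AddCommMonoid M] (f : ℕ → M) (n : ℕ) :
    ∑ i ∈ Finset.Icc 1 n, f i = ∑ i ∈ Finset.range n, f (i + 1) := by
  induction n with
  | zero => simp
  | succ n ih => rw [Finset.sum_Icc_succ_top (by omega), Finset.sum_range_succ, ih]

theorem two_mul_sum_listGraph (l : List (ℕ × ℕ)) :
    2 * ∑ i ∈ Finset.range (listHeight l), listGraph l ((i + 1 : ℕ) : ℝ) = twiceSum l := by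
  induction l with
  | nil => simp [listHeight, twiceSum]
  | cons s l ih =>
    rw [listHeight_cons, Nat.add_comm, Finset.sum_range_add, mul_add]
    have h1 : ∑ i ∈ Finset.range (listHeight l), listGraph (s :: l) ((i + 1 : ℕ) : ℝ)
        = ∑ i ∈ Finset.range (listHeight l), listGraph l ((i + 1 : ℕ) : ℝ) :=
      Finset.sum_congr rfl fun i hi => by
        rw [listGraph, if_pos]
        exact_mod_cast Finset.mem_range.1 hi
    -- The values along a segment form an arithmetic progression; only at `n = s.1 + s.2` does the
    -- slope clear its denominator.
    have h2 : ∀ n : ℕ, 2 * ∑ i ∈ Finset.range n,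
        listGraph (s :: l) ((listHeight l + i + 1 : ℕ) : ℝ)
        = 2 * n * l.sum.2 + segmentSlope s * (n * (n + 1)) := by
      intro n
      induction n with
      | zero => simp
      | succ n ih =>
        have hgt : ¬ ((listHeight l + n + 1 : ℕ) : ℝ) ≤ listHeight l := by
          rw [Nat.cast_le]
          omega
        rw [Finset.sum_range_succ, mul_add, ih, listGraph, if_neg hgt, listDim_eq]
        push_cast
        ring
    rw [h1, ih, h2, twiceSum]
    have h3 := segmentSlope_mul s
    push_cast
    linear_combination ((s.1 : ℝ) + s.2 + 1) * h3

theorem c_eq {ζ ξ : NewtonPolygon} (h : ζ.height = ξ.height) :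
    ζ.c ξ = ((twiceSum ζ.segs - twiceSum ξ.segs : ℤ) : ℝ) := by
  rw [c, Finset.sum_sub_distrib, mul_sub, sum_Icc_one, sum_Icc_one]
  push_cast
  rw [← two_mul_sum_listGraph ζ.segs, ← two_mul_sum_listGraph ξ.segs]
  nth_rw 1 [← h]
  push_cast
  rfl

end NewtonPolygon

/-! ### Truncated Dieudonne modules of labelled self-maps -/

section Realizes

variable {p : ℕ} [Fact p.Prime] {k : Type u} [Field k] [CharP k p] [PerfectRing k p]

/-- `M` has a basis on which `F` and `V` act along the arrows of the labelled self-map `X`. -/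
def Realizes (M : DMOne p k) (X : LabelledMap) : Prop :=
  ∃ e : M.carrier ≃ₗ[k] (X.carrier → k),
    (∀ x z, e (M.F x) (X.map z) = if X.label z = 0 then frobeniusEquiv k p (e x z) else 0) ∧
    ∀ x z, e (M.V x) z = if X.label z = 1 then (frobeniusEquiv k p).symm (e x (X.map z)) else 0

theorem realizes_toDMOne {h : ℕ} (A : ZeroOneSeq h) :
    Realizes (A.toDMOne p k) (LabelledMap.ofSeq A) := by
  refine ⟨LinearEquiv.refl k _, fun x (z : Fin h) => ?_, fun x z => rfl⟩
  change (if A ((ZeroOneSeq.arrowEquiv A).symm (ZeroOneSeq.arrowEquiv A z)) = 0 then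
    frobeniusEquiv k p (x ((ZeroOneSeq.arrowEquiv A).symm (ZeroOneSeq.arrowEquiv A z))) else 0)
    = if A z = 0 then frobeniusEquiv k p (x z) else 0
  rw [(ZeroOneSeq.arrowEquiv A).symm_apply_apply]

theorem Realizes.of_iso {M : DMOne p k} {X Y : LabelledMap} (h : Realizes M X)
    (hXY : LabelledMap.Iso X Y) : Realizes M Y := by
  obtain ⟨e, hF, hV⟩ := h
  obtain ⟨f, hl, hm⟩ := hXY
  have hl' : ∀ z, X.label (f.symm z) = Y.label z := fun z => by rw [← hl, f.apply_symm_apply]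
  have hm' : ∀ z, f.symm (Y.map z) = X.map (f.symm z) := fun z => by
    rw [f.symm_apply_eq, hm, f.apply_symm_apply]
  refine ⟨e.trans (LinearEquiv.funCongrLeft k k f.symm), fun x z => ?_, fun x z => ?_⟩
  · change e (M.F x) (f.symm (Y.map z)) = if _ then frobeniusEquiv k p (e x (f.symm z)) else 0
    rw [hm', hF, hl']
  · change e (M.V x) (f.symm z) = if _ then (frobeniusEquiv k p).symm (e x (f.symm (Y.map z))) else 0
    rw [hm', hV, hl']

theorem Realizes.of_isIso {M N : DMOne p k} {X : LabelledMap} (h : Realizes N X)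
    (hMN : M.IsIso N) : Realizes M X := by
  obtain ⟨e, hF, hV⟩ := h
  obtain ⟨f, hF', hV'⟩ := hMN
  refine ⟨f.trans e, fun x z => ?_, fun x z => ?_⟩
  · change e (f (M.F x)) _ = if _ then frobeniusEquiv k p (e (f x) z) else 0
    rw [hF', hF]
  · change e (f (M.V x)) _ = if _ then (frobeniusEquiv k p).symm (e (f x) (X.map z)) else 0
    rw [hV', hV]

theorem Realizes.prod {M N : DMOne p k} {X Y : LabelledMap} (hM : Realizes M X)
    (hN : Realizes N Y) : Realizes (M.prod N) (X.sum Y) := by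
  obtain ⟨e, hF, hV⟩ := hM
  obtain ⟨f, hF', hV'⟩ := hN
  refine ⟨(e.prodCongr f).trans
    (LinearEquiv.sumArrowLequivProdArrow X.carrier Y.carrier k k).symm, ?_, ?_⟩
  · rintro x (z | z)
    · exact hF x.1 z
    · exact hF' x.2 z
  · rintro x (z | z)
    · exact hV x.1 z
    · exact hV' x.2 z

/-- The arrow of a sequence is onto, so the formulas at the heads of arrows determine every
coordinate of `F x`. -/
theorem Realizes.corresponds {M : DMOne p k} {h : ℕ} {A : ZeroOneSeq h}
    (hM : Realizes M (LabelledMap.ofSeq A)) : M.Corresponds A := by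
  obtain ⟨e, hF, hV⟩ := hM
  obtain ⟨f, hF', hV'⟩ := realizes_toDMOne (p := p) (k := k) A
  refine ⟨e.trans f.symm, fun x => ?_, fun x => ?_⟩
  · rw [LinearEquiv.trans_apply, f.symm_apply_eq]
    ext j
    obtain ⟨i, rfl⟩ := (ZeroOneSeq.arrowEquiv A).surjective j
    have h1 := hF x i
    have h2 := hF' ((e.trans f.symm) x) i
    rw [LinearEquiv.trans_apply, f.apply_symm_apply] at h2
    exact h1.trans h2.symm
  · rw [LinearEquiv.trans_apply, f.symm_apply_eq]
    ext i
    have h1 := hV x i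
    have h2 := hV' ((e.trans f.symm) x) i
    rw [LinearEquiv.trans_apply, f.apply_symm_apply] at h2
    exact h1.trans h2.symm

theorem isDirectSum_of_iso {a b c : ℕ} {A : ZeroOneSeq a} {B : ZeroOneSeq b} {C : ZeroOneSeq c}
    (h : LabelledMap.Iso (LabelledMap.ofSeq C)
      ((LabelledMap.ofSeq A).sum (LabelledMap.ofSeq B))) : ZeroOneSeq.IsDirectSum p k A B C :=
  (((realizes_toDMOne A).prod (realizes_toDMOne B)).of_iso h.symm).corresponds

theorem ofSeq_simpleSeq_iso (s : ℕ × ℕ) :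
    LabelledMap.Iso (LabelledMap.ofSeq (simpleSeq s.1 s.2)) (LabelledMap.simple s) := by
  refine LabelledMap.iso_ofList_of_eq _ (List.ext_getElem (by simp) fun i h1 h2 => ?_)
  rw [List.getElem_ofFn, List.getElem_append]
  by_cases hi : i < s.1 <;> simp [simpleSeq, hi]

theorem realizes_pi (l : List (ℕ × ℕ)) :
    Realizes (DMOne.pi fun i : Fin l.length =>
      (simpleSeq (l.get i).1 (l.get i).2).toDMOne p k) (LabelledMap.simpleSum l) := by
  induction l with
  | nil =>
    refine ⟨⟨⟨⟨fun _ z => z.elim, fun _ _ => funext fun z => z.elim⟩,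
      fun _ _ => funext fun z => z.elim⟩, fun _ i => i.elim0,
      fun _ => funext fun i => i.elim0, fun _ => funext fun z => z.elim⟩,
      fun x z => z.elim, fun x z => z.elim⟩
  | cons s l ih =>
    refine (((realizes_toDMOne (simpleSeq s.1 s.2)).of_iso (ofSeq_simpleSeq_iso s)).prod
      ih).of_isIso ⟨(Fin.consLinearEquiv k fun i : Fin (l.length + 1) =>
        ((simpleSeq ((s :: l).get i).1 ((s :: l).get i).2).toDMOne p k).carrier).symm, ?_, ?_⟩
    · intro x
      rfl
    · intro x
      rfl

theorem realizes_minimalDMOne (ζ : NewtonPolygon) :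
    Realizes (minimalDMOne p k ζ) (LabelledMap.simpleSum ζ.segs) := realizes_pi ζ.segs

end Realizes

/-! ### Chains of sequences -/

namespace LabelledMap

variable (p : ℕ) [Fact p.Prime] (k : Type u) [Field k] [CharP k p] [PerfectRing k p]

theorem isAdjacentExchange_get (s t : List (Fin 2)) :
    ∃ Q' : ZeroOneSeq (s ++ 0 :: 1 :: t).length,
      ZeroOneSeq.IsAdjacentExchange Q' (s ++ 0 :: 1 :: t).get ∧
        Iso (ofSeq Q') (ofList (s ++ 1 :: 0 :: t)) := by
  let i : Fin (s ++ 0 :: 1 :: t).length := ⟨s.length, by simp⟩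
  let j : Fin (s ++ 0 :: 1 :: t).length := ⟨s.length + 1, by simp⟩
  refine ⟨_, ⟨i, j, rfl, by simp [i], by simp [j], rfl⟩, iso_ofList_of_eq _ ?_⟩
  refine List.ext_getElem (by
    simp only [List.length_ofFn, List.length_append, List.length_cons]) fun n h1 h2 => ?_
  rw [List.getElem_ofFn]
  rw [List.length_ofFn] at h1
  rcases lt_trichotomy n s.length with hn | rfl | hn
  · rw [Function.comp_apply, Equiv.swap_apply_of_ne_of_ne (by simp [i, Fin.ext_iff]; omega)
      (by simp [j, Fin.ext_iff]; omega)]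
    simp [hn]
  · rw [Function.comp_apply, show (⟨s.length, h1⟩ : Fin _) = i from rfl, Equiv.swap_apply_left]
    simp [j]
  · obtain ⟨m, rfl⟩ := Nat.exists_eq_add_of_lt hn
    rcases m with _ | m
    · rw [Function.comp_apply, show (⟨s.length + 0 + 1, h1⟩ : Fin _) = j from rfl,
        Equiv.swap_apply_right]
      simp [i]
    · rw [Function.comp_apply, Equiv.swap_apply_of_ne_of_ne (by simp [i, Fin.ext_iff]; omega)
        (by simp [j, Fin.ext_iff])]
      simp only [List.get_eq_getElem, List.getElem_append,
        show s.length + (m + 1) + 1 - s.length = m + 1 + 1 by omega, List.getElem_cons_succ]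

theorem Step.isElementaryStep {h : ℕ} {X Y : LabelledMap} {A B : ZeroOneSeq h} (hXY : Step X Y)
    (hX : Iso X (ofSeq B)) (hY : Iso Y (ofSeq A)) : ZeroOneSeq.IsElementaryStep p k B A := by
  obtain ⟨r, s, t, h1, h2⟩ := hXY
  obtain ⟨Q', hQ, hQ'⟩ := isAdjacentExchange_get s t
  exact ⟨_, _, r.get, Q', _, hQ,
    isDirectSum_of_iso ((hX.symm.trans h1).trans ((Iso.refl _).sum hQ'.symm)),
    isDirectSum_of_iso (hY.symm.trans h2)⟩

/-- Counting points shows that the height is unchanged, so all sequences of a chain live in the same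
`{0,1}^h`. -/
theorem Step.exists_iso_ofSeq {h : ℕ} {X Y : LabelledMap} {B : ZeroOneSeq h} (hXY : Step X Y)
    (hX : Iso X (ofSeq B)) : ∃ A : ZeroOneSeq h, Iso Y (ofSeq A) := by
  obtain ⟨r, s, t, h1, h2⟩ := hXY
  obtain ⟨e, -⟩ := hX.symm.trans h1
  have hcard : h = r.length + (s ++ 0 :: 1 :: t).length := by
    have e' : Fin h ≃ Fin r.length ⊕ Fin (s ++ 1 :: 0 :: t).length := e
    have := Fintype.card_congr e'
    simp only [Fintype.card_fin, Fintype.card_sum, List.length_append, List.length_cons] at this ⊢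
    exact this
  subst hcard
  obtain ⟨C, hC⟩ := exists_sum_iso_ofSeq r.get (s ++ 0 :: 1 :: t).get
  exact ⟨C, h2.trans hC⟩

theorem Chain.exists_seq {r h : ℕ} {X Y : LabelledMap} (hXY : Chain r X Y) (B : ZeroOneSeq h)
    (hB : Iso X (ofSeq B)) :
    ∃ A : Fin (r + 1) → ZeroOneSeq h, A 0 = B ∧ Iso Y (ofSeq (A (Fin.last r))) ∧
      ∀ i : Fin r, ZeroOneSeq.IsElementaryStep p k (A i.castSucc) (A i.succ) := by
  induction hXY generalizing B with
  | nil hXY => exact ⟨fun _ => B, rfl, hXY.symm.trans hB, fun i => i.elim0⟩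
  | cons hXY _ ih =>
    obtain ⟨A₀, hA₀⟩ := hXY.exists_iso_ofSeq hB
    obtain ⟨A, rfl, h2, h3⟩ := ih A₀ hA₀
    refine ⟨Fin.cons B A, rfl, ?_, fun i => ?_⟩
    · rw [← Fin.succ_last, Fin.cons_succ]
      exact h2
    · refine Fin.cases ?_ (fun i => ?_) i
      · simpa using hXY.isElementaryStep p k hB hA₀
      · simpa [← Fin.succ_castSucc] using h3 i

theorem exists_iso_ofSeq_simpleSum (l : List (ℕ × ℕ)) :
    ∃ A : ZeroOneSeq (NewtonPolygon.listHeight l), Iso (simpleSum l) (ofSeq A) := by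
  induction l with
  | nil => exact ⟨Fin.elim0, Equiv.equivOfIsEmpty Empty (Fin 0), fun x => x.elim, fun x => x.elim⟩
  | cons s l ih =>
    obtain ⟨A, hA⟩ := ih
    obtain ⟨C, hC⟩ := exists_sum_iso_ofSeq (simpleSeq s.1 s.2) A
    rw [NewtonPolygon.listHeight_cons]
    exact ⟨C, ((ofSeq_simpleSeq_iso s).symm.sum hA).trans hC⟩

end LabelledMap

theorem theorem1 (p : ℕ) [Fact p.Prime] (k : Type u) [Field k] [CharP k p] [IsAlgClosed k]
    (h : ℕ) (ζ ξ : NewtonPolygon) (hζ : ζ.height = h) (hξ : ξ.height = h) (hprec : ζ.Prec ξ) :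
    ∃ c : ℕ, (c : ℝ) = ζ.c ξ ∧
      ∃ (M : Fin (c + 1) → DMOne p k) (A : Fin (c + 1) → ZeroOneSeq h),
        M 0 = minimalDMOne p k ζ ∧
        M (Fin.last c) = minimalDMOne p k ξ ∧
        (∀ i, (M i).Corresponds (A i)) ∧
        ∀ i : Fin c,
          ZeroOneSeq.LT p k (A i.castSucc) (A i.succ) ∧
          ZeroOneSeq.IsElementaryStep p k (A i.castSucc) (A i.succ) := by
  obtain ⟨r, hr, hchain, hzero⟩ :=
    LabelledMap.exists_chain_of_liesAbove ζ.segs ξ.segs hprec.liesAbove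
  subst hζ
  obtain ⟨B, hB⟩ := LabelledMap.exists_iso_ofSeq_simpleSum ζ.segs
  obtain ⟨A, rfl, hlast, hstep⟩ := hchain.exists_seq p k B hB
  -- The end modules must equal the minimal ones, not merely be isomorphic to them, so they are put
  -- in literally. For `r = 0` the two ends coincide and `hzero` identifies the polygons.
  refine ⟨r, ?_, fun i => if i = 0 then minimalDMOne p k ζ else if i = Fin.last r then
    minimalDMOne p k ξ else (A i).toDMOne p k, A, if_pos rfl, ?_, fun i => ?_,
    fun i => ⟨.single (hstep i), hstep i⟩⟩
  · rw [NewtonPolygon.c_eq hξ.symm, hr]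
    simp
  · rcases Nat.eq_zero_or_pos r with rfl | hpos
    · obtain ⟨l, h1, h2⟩ := ζ
      obtain ⟨l', h1', h2'⟩ := ξ
      obtain rfl : l = l' := hzero rfl
      rfl
    · simp only
      rw [if_neg (by simp [Fin.ext_iff]; omega), if_pos trivial]
  · simp only
    split_ifs with h0 h1
    · subst h0
      exact ((realizes_minimalDMOne ζ).of_iso hB).corresponds
    · subst h1
      exact ((realizes_minimalDMOne ξ).of_iso hlast).corresponds
    · exact (realizes_toDMOne (A i)).corresponds
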